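/- Let $d\ge 1$, let $\mathcal D\subset\mathbb R^d$ be a bounded connected open set with Lipschitz boundary, and let $\alpha,\beta>0$. Let $\mathcal S_{\alpha,\beta}$ be the set of symmetric matrices $M\in\mathbb R^{d\times d}$ such that $\alpha|\xi|^2\le \xi^TM\xi$ and $|\xi^TM\eta|\le\beta|\xi||\eta|$ for all $\xi,\eta\in\mathbb R^d$. Let $A_{\rm per}\in L^\infty(\mathbb R^d,\mathcal S_{\alpha,\beta})$ be $\mathbb Z^d$-periodic, let $\varepsilon>0$, and put $A_\varepsilon(x)=A_{\rm per}(x/\varepsilon)$. Put $L^2_m(\partial\mathcal D)=\{g\in L^2(\partial\mathcal D):\int_{\partial\mathcal D}g=0\}$ and $H^1_m(\mathcal D)=\{u\in H^1(\mathcal D):\int_{\partial\mathcal D}u=0\}$. For $g\in L^2_m(\partial\mathcal D)$ and $A=A_\varepsilon$ or $A=\overline A\in\mathcal S_{\alpha,\beta}$ constant, the problem $-\mathrm{div}(A\nabla u)=0$ in $\mathcal D$, $(A\nabla u)\cdot n=g$ on $\partial\mathcal D$, that is, $$\int_{\mathcal D}\nabla v^TA\nabla u=\int_{\partial\mathcal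 D}g\,v\qquad\text{for all }v\in H^1(\mathcal D),$$ has a unique weak solution $u=u(A,g)\in H^1_m(\mathcal D)$. Define the energy $$\mathcal E(A,g)=\frac12\int_{\mathcal D}\nabla u^TA\nabla u-\int_{\partial\mathcal D}g\,u$$ and, for $\overline A\in\mathcal S_{\alpha,\beta}$, $$\Psi_\varepsilon(\overline A)=\sup\bigl\{|\mathcal E(A_\varepsilon,g)-\mathcal E(\overline A,g)|:\ g\in L^2_m(\partial\mathcal D),\ \|g\|_{L^2(\partial\mathcal D)}=1\bigr\}.$$ Then there exists $\overline A_\varepsilon^{\#}\in\mathcal S_{\alpha,\beta}$ such that $$\Psi_\varepsilon(\overline A_\varepsilon^{\#})=\inf_{\overline A\in\mathcal S_{\alpha,\beta}}\Psi_\varepsilon(\overline A)<\infty.$$ -/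

import Mathlib

open MeasureTheory Filter Topology
open scoped ENNReal NNReal Matrix ContDiff

noncomputable section

namespace EffectiveCoefficient

/-- The bilinear form `ξᵀ M η` of a matrix. -/
def bilin {d : ℕ} (M : Matrix (Fin d) (Fin d) ℝ) (ξ η : EuclideanSpace ℝ (Fin d)) : ℝ :=
  ξ.ofLp ⬝ᵥ (M *ᵥ η.ofLp)

/-- The set `S_{α,β}` of symmetric, `α`-coercive, `β`-bounded matrices. -/
def coeffSet (d : ℕ) (α β : ℝ) : Set (Matrix (Fin d) (Fin d) ℝ) :=
  {M | M.IsSymm ∧ (∀ ξ : EuclideanSpace ℝ (Fin d), α * ‖ξ‖ ^ 2 ≤ bilin M ξ ξ) ∧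
    ∀ ξ η : EuclideanSpace ℝ (Fin d), |bilin M ξ η| ≤ β * ‖ξ‖ * ‖η‖}

/-- Bounded Lipschitz domain: a bounded, connected (in particular nonempty), open set which, near
each boundary point and in suitable orthonormal coordinates, is the strict epigraph of a
Lipschitz function. Here `ν` is the direction of the last coordinate and `(ℝ ∙ ν)ᗮ` is the
hyperplane of the remaining ones. -/
structure IsLipschitzDomain {d : ℕ} (D : Set (EuclideanSpace ℝ (Fin d))) : Prop where
  isOpen : IsOpen D
  isConnected : IsConnected D
  isBounded : Bornology.IsBounded D
  local_epigraph : ∀ x₀ ∈ frontier D, ∃ ν : EuclideanSpace ℝ (Fin d), ‖ν‖ = 1 ∧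
    ∃ (K : ℝ≥0) (γ : (Submodule.span ℝ {ν})ᗮ → ℝ), LipschitzWith K γ ∧
      ∃ r > 0, ∀ y ∈ Metric.ball x₀ r,
        (y ∈ D ↔ γ ((Submodule.span ℝ {ν})ᗮ.orthogonalProjectionOnto y) < inner ℝ ν y)

/-- Lebesgue measure on `D`. -/
abbrev bulk {d : ℕ} (D : Set (EuclideanSpace ℝ (Fin d))) : Measure (EuclideanSpace ℝ (Fin d)) :=
  volume.restrict D

/-- Surface measure on `∂D`: the `(d-1)`-dimensional Hausdorff measure, with the normalization
that makes it agree with Lebesgue measure on hyperplanes. -/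
abbrev surf {d : ℕ} (D : Set (EuclideanSpace ℝ (Fin d))) : Measure (EuclideanSpace ℝ (Fin d)) :=
  (Measure.euclideanHausdorffMeasure (d - 1)).restrict (frontier D)

/-- `G` is the weak (distributional) gradient of `u` in `D`. -/
def HasWeakGradient {d : ℕ} (D : Set (EuclideanSpace ℝ (Fin d)))
    (u : EuclideanSpace ℝ (Fin d) → ℝ)
    (G : EuclideanSpace ℝ (Fin d) → EuclideanSpace ℝ (Fin d)) : Prop :=
  ∀ φ : EuclideanSpace ℝ (Fin d) → ℝ, ContDiff ℝ ∞ φ → HasCompactSupport φ → tsupport φ ⊆ D →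
    ∀ i : Fin d, ∫ x in D, u x * gradient φ x i = -∫ x in D, G x i * φ x

/-- `t ∈ L²(∂D)` is the boundary trace of the `H¹(D)` function `u` with gradient `G`: the trace is
the continuous extension to `H¹(D)` of the restriction to `∂D` of functions smooth up to the
boundary, so `t` is the `L²(∂D)` limit of `φ n` on `∂D` for smooth `φ n` that converge to `u` in
`H¹(D)`. -/
def IsTrace {d : ℕ} (D : Set (EuclideanSpace ℝ (Fin d)))
    (u : EuclideanSpace ℝ (Fin d) → ℝ)
    (G : EuclideanSpace ℝ (Fin d) → EuclideanSpace ℝ (Fin d))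
    (t : EuclideanSpace ℝ (Fin d) → ℝ) : Prop :=
  ∃ φ : ℕ → EuclideanSpace ℝ (Fin d) → ℝ, (∀ n, ContDiff ℝ ∞ (φ n)) ∧
    Tendsto (fun n => eLpNorm (fun x => φ n x - u x) 2 (bulk D)) atTop (𝓝 0) ∧
    Tendsto (fun n => eLpNorm (fun x => gradient (φ n) x - G x) 2 (bulk D)) atTop (𝓝 0) ∧
    Tendsto (fun n => eLpNorm (fun x => φ n x - t x) 2 (surf D)) atTop (𝓝 0)

/-- An element of `H¹(D)`, with representatives of its weak gradient and of its trace on `∂D`.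
(In a bounded Lipschitz domain every `u ∈ L²(D)` with weak gradient in `L²(D)` has exactly one
trace up to null sets, so carrying the trace along is no restriction.) -/
structure H1 {d : ℕ} (D : Set (EuclideanSpace ℝ (Fin d))) where
  toFun : EuclideanSpace ℝ (Fin d) → ℝ
  grad : EuclideanSpace ℝ (Fin d) → EuclideanSpace ℝ (Fin d)
  trace : EuclideanSpace ℝ (Fin d) → ℝ
  memLp_toFun : MemLp toFun 2 (bulk D)
  memLp_grad : MemLp grad 2 (bulk D)
  memLp_trace : MemLp trace 2 (surf D)
  hasWeakGradient : HasWeakGradient D toFun grad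
  isTrace : IsTrace D toFun grad trace

/-- `L²_m(∂D)`: square integrable functions on `∂D` with zero mean. -/
def L2m {d : ℕ} (D : Set (EuclideanSpace ℝ (Fin d))) : Set (Lp ℝ 2 (surf D)) :=
  {g | ∫ x, g x ∂(surf D) = 0}

/-- `u` is the weak solution in `H¹_m(D)` (zero mean on `∂D`) of `-div (A ∇u) = 0` in `D`,
`(A ∇u) · n = g` on `∂D`. -/
def IsNeumannSolution {d : ℕ} (D : Set (EuclideanSpace ℝ (Fin d)))
    (A : EuclideanSpace ℝ (Fin d) → Matrix (Fin d) (Fin d) ℝ) (g : Lp ℝ 2 (surf D))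
    (u : H1 D) : Prop :=
  ∫ x, u.trace x ∂(surf D) = 0 ∧
  ∀ v : H1 D, ∫ x in D, bilin (A x) (v.grad x) (u.grad x) = ∫ x, g x * v.trace x ∂(surf D)

/-- Existence and uniqueness of the weak solution in `H¹_m(D)`. -/
def WellPosed {d : ℕ} (D : Set (EuclideanSpace ℝ (Fin d)))
    (A : EuclideanSpace ℝ (Fin d) → Matrix (Fin d) (Fin d) ℝ) (g : Lp ℝ 2 (surf D)) : Prop :=
  ∃ u : H1 D, IsNeumannSolution D A g u ∧
    ∀ w : H1 D, IsNeumannSolution D A g w → w.toFun =ᵐ[bulk D] u.toFun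

open Classical in
/-- The energy `E(A,g) = ½ ∫_D ∇uᵀ A ∇u - ∫_{∂D} g u`, where `u` is the weak solution
(the default value `0` is used if there is none). -/
def energy {d : ℕ} (D : Set (EuclideanSpace ℝ (Fin d)))
    (A : EuclideanSpace ℝ (Fin d) → Matrix (Fin d) (Fin d) ℝ) (g : Lp ℝ 2 (surf D)) : ℝ :=
  if h : ∃ u : H1 D, IsNeumannSolution D A g u then
    (1 / 2) * (∫ x in D, bilin (A x) (h.choose.grad x) (h.choose.grad x))
      - ∫ x, g x * h.choose.trace x ∂(surf D)
  else 0

/-- `Ψ(Ā) = sup { |E(A,g) - E(Ā,g)| : g ∈ L²_m(∂D), ‖g‖ = 1 } ∈ [0,∞]`, for a given coefficient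
field `A` and a constant coefficient `Ā`. -/
def Psi {d : ℕ} (D : Set (EuclideanSpace ℝ (Fin d)))
    (A : EuclideanSpace ℝ (Fin d) → Matrix (Fin d) (Fin d) ℝ)
    (Abar : Matrix (Fin d) (Fin d) ℝ) : ℝ≥0∞ :=
  ⨆ g ∈ {g : Lp ℝ 2 (surf D) | g ∈ L2m D ∧ ‖g‖ = 1},
    ENNReal.ofReal |energy D A g - energy D (fun _ => Abar) g|

/-- `A_per ∈ L^∞(ℝ^d, S_{α,β})` and `A_per` is `ℤ^d`-periodic (as an element of `L^∞`). -/
structure IsPeriodicCoeff {d : ℕ} (α β : ℝ)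
    (Aper : EuclideanSpace ℝ (Fin d) → Matrix (Fin d) (Fin d) ℝ) : Prop where
  aemeasurable : ∀ i j, AEMeasurable (fun x => Aper x i j) volume
  mem_coeffSet : ∀ᵐ x, Aper x ∈ coeffSet d α β
  periodic : ∀ k : Fin d → ℤ,
    (fun x => Aper (x + WithLp.toLp 2 (fun i => (k i : ℝ)))) =ᵐ[volume] Aper

/-- The rescaled coefficient `A_ε(x) = A_per(x/ε)`. -/
def rescale {d : ℕ} (Aper : EuclideanSpace ℝ (Fin d) → Matrix (Fin d) (Fin d) ℝ) (ε : ℝ) :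
    EuclideanSpace ℝ (Fin d) → Matrix (Fin d) (Fin d) ℝ :=
  fun x => Aper (ε⁻¹ • x)

end EffectiveCoefficient

end

noncomputable section

namespace EffectiveCoefficient

/-! The set $\mathcal S_{\alpha,\beta}$ is closed and bounded in a finite-dimensional space, hence
compact, and it contains a value of `Aper`. A lower semicontinuous function attains its minimum
there, and `Psi` is a supremum over $g$ of functions of $\overline A$, so it is enough that each
$\mathcal E(\cdot,g)$ is continuous.

Testing the equation with its own solution gives $\mathcal E(A,g)=-\frac12\int_{\partial\mathcal
D}g\,u$. If $u,w$ solve the problems for $M,N$, testing each equation with the other solution gives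
$\mathcal E(M,g)-\mathcal E(N,g)=\frac12\int\nabla u^T(M-N)\nabla w$. The a priori bound $\|u\|\le
C\|g\|$ turns this into a Lipschitz estimate (`exists_abs_energy_sub_le`), and also bounds the
energies uniformly for $\|g\|=1$, so that `Psi` is finite.

Both this bound and well-posedness (Lax–Milgram) rest on the inequality $\|u\|\le C\|\nabla u\|$ for
zero boundary mean (`exists_norm_le_gradL`). It needs a Poincaré inequality, a trace inequality and
$0<|\partial\mathcal D|<\infty$, all derived from the local epigraph description of $\mathcal D$ for
$C^1$ functions, then extended by density to the closure `sobolev` of smooth triples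
$(\varphi,\nabla\varphi,\varphi|_{\partial\mathcal D})$. -/

/-! ### Square-integral estimates for increments. -/

theorem ennreal_add_sq_le (a b : ℝ≥0∞) : (a + b) ^ 2 ≤ 2 * (a ^ 2 + b ^ 2) := by
  induction a with
  | top => simp
  | coe a =>
    induction b with
    | top => simp
    | coe b => exact_mod_cast (add_sq_le : (a + b) ^ 2 ≤ 2 * (a ^ 2 + b ^ 2))

theorem enorm_sub_sq_le (a b c : ℝ) :
    ‖a - c‖ₑ ^ 2 ≤ 2 * (‖a - b‖ₑ ^ 2 + ‖b - c‖ₑ ^ 2) := by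
  refine le_trans ?_ (ennreal_add_sq_le _ _)
  gcongr
  simpa [edist_eq_enorm_sub] using edist_triangle a b c

theorem lintegral_two_mul_add {X : Type*} [MeasurableSpace X] {μ : Measure X} {f g : X → ℝ≥0∞}
    (hf : Measurable f) (hg : Measurable g) :
    ∫⁻ x, 2 * (f x + g x) ∂μ = 2 * ((∫⁻ x, f x ∂μ) + ∫⁻ x, g x ∂μ) := by
  rw [lintegral_const_mul _ (by fun_prop), lintegral_add_left hf]

theorem lintegral_sq_le {X : Type*} [MeasurableSpace X] (μ : Measure X) {f : X → ℝ≥0∞}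
    (hf : AEMeasurable f μ) : (∫⁻ x, f x ∂μ) ^ 2 ≤ μ Set.univ * ∫⁻ x, f x ^ 2 ∂μ := by
  have h := ENNReal.lintegral_mul_le_Lp_mul_Lq μ Real.HolderConjugate.two_two
    (aemeasurable_const (b := (1 : ℝ≥0∞))) hf
  simp only [Pi.mul_apply, one_mul, ENNReal.one_rpow, lintegral_const] at h
  calc (∫⁻ x, f x ∂μ) ^ 2
      ≤ ((μ Set.univ) ^ (1 / 2 : ℝ) * (∫⁻ x, f x ^ (2 : ℝ) ∂μ) ^ (1 / 2 : ℝ)) ^ 2 := by gcongr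
    _ = μ Set.univ * ∫⁻ x, f x ^ 2 ∂μ := by
      rw [mul_pow, ← ENNReal.rpow_natCast, ← ENNReal.rpow_natCast, ← ENNReal.rpow_mul,
        ← ENNReal.rpow_mul]
      norm_num

variable {d : ℕ}

theorem continuous_gradient {φ : EuclideanSpace ℝ (Fin d) → ℝ} (hφ : ContDiff ℝ 1 φ) :
    Continuous (gradient φ) :=
  (InnerProductSpace.toDual ℝ _).symm.continuous.comp (hφ.continuous_fderiv (by simp))

theorem inner_gradient (φ : EuclideanSpace ℝ (Fin d) → ℝ) (x v : EuclideanSpace ℝ (Fin d)) :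
    inner ℝ (gradient φ x) v = fderiv ℝ φ x v := by
  simp [gradient]

/-- Squared increments along a line are controlled by the gradient on the segment. -/
theorem enorm_increment_sq_le {φ : EuclideanSpace ℝ (Fin d) → ℝ} (hφ : ContDiff ℝ 1 φ)
    (y v : EuclideanSpace ℝ (Fin d)) {t : ℝ} (ht : 0 < t) :
    ‖φ (y + t • v) - φ y‖ₑ ^ 2 ≤
      ENNReal.ofReal t * (‖v‖ₑ ^ 2 * ∫⁻ s in Set.Ioo 0 t, ‖gradient φ (y + s • v)‖ₑ ^ 2) := by
  have hc : Continuous fun s : ℝ => gradient φ (y + s • v) :=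
    (continuous_gradient hφ).comp (by fun_prop)
  have hder : ∀ s ∈ Set.uIcc 0 t,
      HasDerivAt (fun s : ℝ => φ (y + s • v)) (inner ℝ (gradient φ (y + s • v)) v) s := by
    intro s _
    rw [inner_gradient]
    have h1 : HasDerivAt (fun s : ℝ => y + s • v) v s := by
      simpa using ((hasDerivAt_id s).smul_const v).const_add y
    exact ((hφ.differentiable (by simp)).differentiableAt.hasFDerivAt).comp_hasDerivAt s h1
  have hint := intervalIntegral.integral_eq_sub_of_hasDerivAt hder
    ((hc.inner continuous_const).intervalIntegrable _ _)
  simp only [zero_smul, add_zero] at hint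
  have hle : ‖φ (y + t • v) - φ y‖ₑ ≤
      ∫⁻ s in Set.Ioo 0 t, ‖gradient φ (y + s • v)‖ₑ * ‖v‖ₑ := by
    rw [← hint, intervalIntegral.integral_of_le ht.le, integral_Ioc_eq_integral_Ioo]
    refine (enorm_integral_le_lintegral_enorm _).trans (lintegral_mono fun s => ?_)
    rw [← ofReal_norm, ← ofReal_norm, ← ofReal_norm, ← ENNReal.ofReal_mul (norm_nonneg _)]
    exact ENNReal.ofReal_le_ofReal (norm_inner_le_norm _ _)
  calc ‖φ (y + t • v) - φ y‖ₑ ^ 2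
      ≤ (∫⁻ s in Set.Ioo 0 t, ‖gradient φ (y + s • v)‖ₑ * ‖v‖ₑ) ^ 2 := by gcongr
    _ ≤ _ := by
      refine (lintegral_sq_le _ (hc.enorm.measurable.mul_const _).aemeasurable).trans ?_
      simp only [Measure.restrict_apply_univ, Real.volume_Ioo, sub_zero, mul_pow]
      rw [lintegral_mul_const _ (hc.enorm.measurable.pow_const 2), mul_comm (‖v‖ₑ ^ 2)]

/-- Integrate the bound along the segment over `S` and exchange the integrals: for fixed `t` the
translate of `S` by `t • h` lies in `D`, and Lebesgue measure is translation invariant. Only the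
open segments have to lie in `D`. -/
theorem lintegral_increment_sq_le {φ : EuclideanSpace ℝ (Fin d) → ℝ} (hφ : ContDiff ℝ 1 φ)
    {D S : Set (EuclideanSpace ℝ (Fin d))} (hD : MeasurableSet D) (hS : MeasurableSet S)
    (h : EuclideanSpace ℝ (Fin d)) (hSD : ∀ y ∈ S, ∀ t ∈ Set.Ioo (0 : ℝ) 1, y + t • h ∈ D) :
    ∫⁻ y in S, ‖φ (y + h) - φ y‖ₑ ^ 2 ≤ ‖h‖ₑ ^ 2 * ∫⁻ x in D, ‖gradient φ x‖ₑ ^ 2 := by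
  have hg : Measurable fun x => ‖gradient φ x‖ₑ ^ 2 :=
    (continuous_gradient hφ).enorm.measurable.pow_const 2
  have hgc : Measurable fun p : EuclideanSpace ℝ (Fin d) × ℝ =>
      ‖gradient φ (p.1 + p.2 • h)‖ₑ ^ 2 := hg.comp (by fun_prop)
  calc ∫⁻ y in S, ‖φ (y + h) - φ y‖ₑ ^ 2
      ≤ ∫⁻ y in S, ‖h‖ₑ ^ 2 * ∫⁻ t in Set.Ioo (0 : ℝ) 1, ‖gradient φ (y + t • h)‖ₑ ^ 2 := by
        refine lintegral_mono fun y => ?_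
        simpa using enorm_increment_sq_le hφ y h one_pos
    _ = ‖h‖ₑ ^ 2 * ∫⁻ t in Set.Ioo (0 : ℝ) 1, ∫⁻ y in S, ‖gradient φ (y + t • h)‖ₑ ^ 2 := by
        rw [lintegral_const_mul _ (hgc.lintegral_prod_right' ), lintegral_lintegral_swap]
        exact hgc.aemeasurable
    _ ≤ ‖h‖ₑ ^ 2 * ∫⁻ t in Set.Ioo (0 : ℝ) 1, ∫⁻ x in D, ‖gradient φ x‖ₑ ^ 2 := by
        refine mul_le_mul_right (setLIntegral_mono' measurableSet_Ioo fun t ht => ?_) _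
        rw [← lintegral_indicator hS, ← lintegral_indicator hD,
          ← lintegral_add_right_eq_self (D.indicator _) (t • h)]
        refine lintegral_mono fun y => ?_
        by_cases hy : y ∈ S
        · simp [hy, hSD y hy t ht]
        · simp [hy]
    _ = _ := by simp

/-! ### Local Poincaré inequalities and their gluing. -/

/-- The Poincaré inequality on `S`, with the gradient taken over all of `D`. -/
def PoincareOn (D S : Set (EuclideanSpace ℝ (Fin d))) : Prop :=
  ∃ C : ℝ≥0, ∀ φ : EuclideanSpace ℝ (Fin d) → ℝ, ContDiff ℝ 1 φ →
    ∃ c : ℝ, ∫⁻ x in S, ‖φ x - c‖ₑ ^ 2 ∂(bulk D) ≤ C * ∫⁻ x in D, ‖gradient φ x‖ₑ ^ 2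

/-- On the overlap `φ` is close to both constants, so `|c₂ - c₁|²` times the measure of `S ∩ T` is
bounded by the gradient integral. Replacing `c₂` by `c₁` on `T` then costs the ratio `q` of
measures. -/
theorem PoincareOn.union {D S T : Set (EuclideanSpace ℝ (Fin d))} (hDb : bulk D Set.univ ≠ ⊤)
    (hST : bulk D (S ∩ T) ≠ 0) (hS : PoincareOn D S) (hT : PoincareOn D T) :
    PoincareOn D (S ∪ T) := by
  obtain ⟨C₁, h₁⟩ := hS
  obtain ⟨C₂, h₂⟩ := hT
  have hfin : ∀ U, bulk D U ≠ ⊤ := fun U => measure_ne_top_of_subset (Set.subset_univ U) hDb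
  set q : ℝ≥0∞ := bulk D T / bulk D (S ∩ T) with hq
  have hqfin : q ≠ ⊤ := ENNReal.div_ne_top (hfin _) hST
  refine ⟨C₁ + 2 * (C₂ + q.toNNReal * (2 * (C₁ + C₂))), fun φ hφ => ?_⟩
  obtain ⟨c₁, hc₁⟩ := h₁ φ hφ
  obtain ⟨c₂, hc₂⟩ := h₂ φ hφ
  set I := ∫⁻ x in D, ‖gradient φ x‖ₑ ^ 2
  have hm : ∀ c : ℝ, Measurable fun x => ‖φ x - c‖ₑ ^ 2 := fun c =>
    (hφ.continuous.sub continuous_const).enorm.measurable.pow_const 2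
  have hcc : ‖c₂ - c₁‖ₑ ^ 2 * bulk D (S ∩ T) ≤ 2 * (C₁ + C₂) * I := by
    calc ‖c₂ - c₁‖ₑ ^ 2 * bulk D (S ∩ T) = ∫⁻ _ in S ∩ T, ‖c₂ - c₁‖ₑ ^ 2 ∂(bulk D) := by
          rw [setLIntegral_const]
      _ ≤ ∫⁻ x in S ∩ T, 2 * (‖φ x - c₂‖ₑ ^ 2 + ‖φ x - c₁‖ₑ ^ 2) ∂(bulk D) := by
          refine lintegral_mono fun x => ?_
          have := enorm_sub_sq_le c₂ (φ x) c₁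
          rwa [← enorm_neg (c₂ - φ x), neg_sub] at this
      _ = 2 * (∫⁻ x in S ∩ T, ‖φ x - c₂‖ₑ ^ 2 ∂(bulk D) +
            ∫⁻ x in S ∩ T, ‖φ x - c₁‖ₑ ^ 2 ∂(bulk D)) := by
          exact lintegral_two_mul_add (hm _) (hm _)
      _ ≤ 2 * (C₂ * I + C₁ * I) := by
          gcongr
          · exact (lintegral_mono_set Set.inter_subset_right).trans hc₂
          · exact (lintegral_mono_set Set.inter_subset_left).trans hc₁
      _ = _ := by ring
  have hcT : ‖c₂ - c₁‖ₑ ^ 2 * bulk D T ≤ q * (2 * (C₁ + C₂) * I) := by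
    calc ‖c₂ - c₁‖ₑ ^ 2 * bulk D T = q * (‖c₂ - c₁‖ₑ ^ 2 * bulk D (S ∩ T)) := by
          rw [mul_left_comm, hq, ENNReal.div_mul_cancel hST (hfin _)]
      _ ≤ _ := by gcongr
  refine ⟨c₁, ?_⟩
  calc ∫⁻ x in S ∪ T, ‖φ x - c₁‖ₑ ^ 2 ∂(bulk D)
      ≤ ∫⁻ x in S, ‖φ x - c₁‖ₑ ^ 2 ∂(bulk D) + ∫⁻ x in T, ‖φ x - c₁‖ₑ ^ 2 ∂(bulk D) :=
        lintegral_union_le _ _ _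
    _ ≤ C₁ * I + ∫⁻ x in T, 2 * (‖φ x - c₂‖ₑ ^ 2 + ‖c₂ - c₁‖ₑ ^ 2) ∂(bulk D) := by
        gcongr with x
        exact enorm_sub_sq_le _ _ _
    _ = C₁ * I + 2 * (∫⁻ x in T, ‖φ x - c₂‖ₑ ^ 2 ∂(bulk D) + ‖c₂ - c₁‖ₑ ^ 2 * bulk D T) := by
        rw [lintegral_two_mul_add (hm _) measurable_const, setLIntegral_const]
    _ ≤ C₁ * I + 2 * (C₂ * I + q * (2 * (C₁ + C₂) * I)) := by gcongr
    _ = _ := by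
        push_cast
        rw [ENNReal.coe_toNNReal hqfin]
        ring

/-- Two points of the ball differ by some `h` of norm below `2 * r`. In the substitution `x = y + h`
the range of `h` is enlarged to that whole ball, independently of `y`, so segments may leave `B`;
they stay in the ball of radius `3 * r`. -/
theorem poincareOn_ball {D : Set (EuclideanSpace ℝ (Fin d))} (hD : IsOpen D)
    {z : EuclideanSpace ℝ (Fin d)} {r : ℝ} (hr : 0 < r) (hz : Metric.ball z (3 * r) ⊆ D) :
    PoincareOn D (Metric.ball z r) := by
  set B := Metric.ball z r with hB
  have hB0 : volume B ≠ 0 := (Metric.measure_ball_pos volume z hr).ne'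
  have hBt : volume B ≠ ⊤ := measure_ball_lt_top.ne
  set K : ℝ≥0∞ := volume (Metric.ball (0 : EuclideanSpace ℝ (Fin d)) (2 * r)) *
    ENNReal.ofReal (2 * r) ^ 2 / volume B with hK
  have hKt : K ≠ ⊤ := ENNReal.div_ne_top
    (ENNReal.mul_ne_top measure_ball_lt_top.ne (ENNReal.pow_ne_top ENNReal.ofReal_ne_top)) hB0
  refine ⟨K.toNNReal, fun φ hφ => ?_⟩
  rw [ENNReal.coe_toNNReal hKt]
  set I := ∫⁻ x in D, ‖gradient φ x‖ₑ ^ 2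
  have hφc := hφ.continuous
  have hm : Measurable fun p : EuclideanSpace ℝ (Fin d) × EuclideanSpace ℝ (Fin d) =>
      ‖φ p.2 - φ p.1‖ₑ ^ 2 := by
    have : Continuous fun p : EuclideanSpace ℝ (Fin d) × EuclideanSpace ℝ (Fin d) =>
      φ p.2 - φ p.1 := by fun_prop
    exact this.enorm.measurable.pow_const 2
  have hm' : Measurable fun p : EuclideanSpace ℝ (Fin d) × EuclideanSpace ℝ (Fin d) =>
      ‖φ (p.1 + p.2) - φ p.1‖ₑ ^ 2 := by
    have : Continuous fun p : EuclideanSpace ℝ (Fin d) × EuclideanSpace ℝ (Fin d) =>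
      φ (p.1 + p.2) - φ p.1 := by fun_prop
    exact this.enorm.measurable.pow_const 2
  have hdouble : ∫⁻ y in B, ∫⁻ x in B, ‖φ x - φ y‖ₑ ^ 2 ≤
      volume (Metric.ball (0 : EuclideanSpace ℝ (Fin d)) (2 * r)) *
        ENNReal.ofReal (2 * r) ^ 2 * I := by
    calc ∫⁻ y in B, ∫⁻ x in B, ‖φ x - φ y‖ₑ ^ 2
        ≤ ∫⁻ y in B, ∫⁻ h in Metric.ball (0 : EuclideanSpace ℝ (Fin d)) (2 * r),
            ‖φ (y + h) - φ y‖ₑ ^ 2 := by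
          refine setLIntegral_mono' measurableSet_ball fun y hy => ?_
          rw [← lintegral_indicator measurableSet_ball, ← lintegral_indicator measurableSet_ball,
            ← lintegral_add_left_eq_self (B.indicator _) y]
          refine lintegral_mono fun h => ?_
          by_cases hh : y + h ∈ B
          · have : h ∈ Metric.ball (0 : EuclideanSpace ℝ (Fin d)) (2 * r) := by
              have h1 := mem_ball_iff_norm.1 hh
              have h2 := mem_ball_iff_norm'.1 hy
              rw [mem_ball_zero_iff]
              calc ‖h‖ = ‖(y + h - z) + (z - y)‖ := by congr 1; abel
                _ ≤ ‖y + h - z‖ + ‖z - y‖ := norm_add_le _ _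
                _ < 2 * r := by linarith
            rw [Set.indicator_of_mem hh, Set.indicator_of_mem this]
          · rw [Set.indicator_of_notMem hh]
            positivity
      _ = ∫⁻ h in Metric.ball (0 : EuclideanSpace ℝ (Fin d)) (2 * r),
            ∫⁻ y in B, ‖φ (y + h) - φ y‖ₑ ^ 2 := lintegral_lintegral_swap hm'.aemeasurable
      _ ≤ ∫⁻ h in Metric.ball (0 : EuclideanSpace ℝ (Fin d)) (2 * r),
            ENNReal.ofReal (2 * r) ^ 2 * I := by
          refine setLIntegral_mono' measurableSet_ball fun h hh => ?_
          rw [mem_ball_zero_iff] at hh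
          refine (lintegral_increment_sq_le hφ hD.measurableSet measurableSet_ball h
            fun y hy t ht => hz ?_).trans ?_
          · rw [mem_ball_iff_norm]
            have h1 := mem_ball_iff_norm.1 hy
            have h2 : ‖t • h‖ ≤ ‖h‖ := by
              rw [norm_smul, Real.norm_of_nonneg ht.1.le]
              exact mul_le_of_le_one_left (norm_nonneg _) ht.2.le
            calc ‖y + t • h - z‖ = ‖(y - z) + t • h‖ := by congr 1; abel
              _ ≤ ‖y - z‖ + ‖t • h‖ := norm_add_le _ _
              _ < 3 * r := by linarith
          · gcongr
            rw [← ofReal_norm]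
            exact ENNReal.ofReal_le_ofReal hh.le
      _ = _ := by rw [setLIntegral_const]; ring
  -- The constant is `φ y` at a point where the inner integral does not exceed its average over `B`.
  obtain ⟨y, -, hy⟩ := exists_le_setLAverage (μ := volume) hB0 hBt
    (f := fun y => ∫⁻ x in B, ‖φ x - φ y‖ₑ ^ 2) (hm.lintegral_prod_right').aemeasurable
  refine ⟨φ y, ?_⟩
  calc ∫⁻ x in B, ‖φ x - φ y‖ₑ ^ 2 ∂(bulk D) ≤ ∫⁻ x in B, ‖φ x - φ y‖ₑ ^ 2 :=
        lintegral_mono' (Measure.restrict_mono le_rfl Measure.restrict_le_self) le_rfl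
    _ ≤ _ := hy
    _ ≤ _ := by
        rw [setLAverage_eq, hK, ← ENNReal.mul_div_right_comm]
        exact ENNReal.div_le_div_right hdouble _

/-! ### Geometry of a local epigraph. -/

/-- `D` agrees on `U` with the strict epigraph of `γ` over the hyperplane orthogonal to `ν`. -/
def IsEpigraphOn (D U : Set (EuclideanSpace ℝ (Fin d))) (ν : EuclideanSpace ℝ (Fin d))
    (γ : (Submodule.span ℝ {ν})ᗮ → ℝ) : Prop :=
  ∀ y ∈ U, (y ∈ D ↔ γ ((Submodule.span ℝ {ν})ᗮ.orthogonalProjectionOnto y) < inner ℝ ν y)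

section Epigraph

variable {D U : Set (EuclideanSpace ℝ (Fin d))} {ν : EuclideanSpace ℝ (Fin d)}
  {γ : (Submodule.span ℝ {ν})ᗮ → ℝ}

theorem projection_add_smul (y ν : EuclideanSpace ℝ (Fin d)) (t : ℝ) :
    (Submodule.span ℝ {ν})ᗮ.orthogonalProjectionOnto (y + t • ν) =
      (Submodule.span ℝ {ν})ᗮ.orthogonalProjectionOnto y := by
  have : (Submodule.span ℝ {ν})ᗮ.orthogonalProjectionOnto ν = 0 := by
    rw [Submodule.orthogonalProjectionOnto_eq_zero_iff, Submodule.orthogonal_orthogonal]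
    exact Submodule.mem_span_singleton_self ν
  rw [map_add, map_smul, this, smul_zero, add_zero]

theorem IsEpigraphOn.le_of_mem_closure (h : IsEpigraphOn D U ν γ) (hU : IsOpen U)
    (hγ : Continuous γ) {y : EuclideanSpace ℝ (Fin d)} (hy : y ∈ closure D) (hyU : y ∈ U) :
    γ ((Submodule.span ℝ {ν})ᗮ.orthogonalProjectionOnto y) ≤ inner ℝ ν y := by
  have hcl : IsClosed {y : EuclideanSpace ℝ (Fin d) |
      γ ((Submodule.span ℝ {ν})ᗮ.orthogonalProjectionOnto y) ≤ inner ℝ ν y} :=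
    isClosed_le (by fun_prop) (by fun_prop)
  have hsub : U ∩ D ⊆ {y : EuclideanSpace ℝ (Fin d) |
      γ ((Submodule.span ℝ {ν})ᗮ.orthogonalProjectionOnto y) ≤ inner ℝ ν y} :=
    fun z hz => ((h z hz.1).1 hz.2).le
  exact hcl.closure_subset_iff.2 hsub (hU.inter_closure ⟨hyU, hy⟩)

theorem IsEpigraphOn.eq_of_mem_frontier (h : IsEpigraphOn D U ν γ) (hU : IsOpen U)
    (hD : IsOpen D) (hγ : Continuous γ) {y : EuclideanSpace ℝ (Fin d)} (hy : y ∈ frontier D)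
    (hyU : y ∈ U) :
    γ ((Submodule.span ℝ {ν})ᗮ.orthogonalProjectionOnto y) = inner ℝ ν y := by
  rw [hD.frontier_eq] at hy
  exact le_antisymm (h.le_of_mem_closure hU hγ hy.1 hyU)
    (not_lt.1 fun hlt => hy.2 ((h y hyU).2 hlt))

/-- Moving along `ν` keeps the projection and raises the height by `t`, so the weak inequality valid
on the closure becomes strict. -/
theorem IsEpigraphOn.add_smul_mem (h : IsEpigraphOn D U ν γ) (hU : IsOpen U) (hν : ‖ν‖ = 1)
    (hγ : Continuous γ) {y : EuclideanSpace ℝ (Fin d)} (hy : y ∈ closure D) (hyU : y ∈ U) {t : ℝ}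
    (ht : 0 < t) (hyt : y + t • ν ∈ U) : y + t • ν ∈ D := by
  rw [h _ hyt, projection_add_smul, inner_add_right, inner_smul_right,
    real_inner_self_eq_norm_sq, hν]
  linarith [h.le_of_mem_closure hU hγ hy hyU]

end Epigraph

theorem add_smul_mem_ball {x₀ y ν : EuclideanSpace ℝ (Fin d)} (hν : ‖ν‖ = 1) {r t : ℝ}
    (hy : y ∈ Metric.ball x₀ (r / 2)) (ht : 0 ≤ t) (htr : t ≤ r / 2) :
    y + t • ν ∈ Metric.ball x₀ r := by
  rw [mem_ball_iff_norm] at hy ⊢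
  have h2 : ‖t • ν‖ = t := by rw [norm_smul, Real.norm_of_nonneg ht, hν, mul_one]
  calc ‖y + t • ν - x₀‖ = ‖(y - x₀) + t • ν‖ := by congr 1; abel
    _ ≤ ‖y - x₀‖ + ‖t • ν‖ := norm_add_le _ _
    _ < r := by linarith

/-- Interior and boundary points are put on the same footing: the zero vector serves at an interior
point, and the epigraph direction, scaled by half the radius, at a boundary point. -/
theorem IsLipschitzDomain.exists_inward_direction {D : Set (EuclideanSpace ℝ (Fin d))}
    (hD : IsLipschitzDomain D) {x₀ : EuclideanSpace ℝ (Fin d)} (hx₀ : x₀ ∈ closure D) :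
    ∃ ν : EuclideanSpace ℝ (Fin d), ∃ r > 0, ∀ y ∈ closure D, y ∈ Metric.ball x₀ r →
      ∀ t ∈ Set.Ioc (0 : ℝ) 1, y + t • ν ∈ D := by
  by_cases hx : x₀ ∈ D
  · obtain ⟨r, hr, hrD⟩ := Metric.isOpen_iff.1 hD.isOpen x₀ hx
    exact ⟨0, r, hr, fun y _ hy t _ => by simpa using hrD hy⟩
  · obtain ⟨ν, hν, K, γ, hγ, r, hr, h⟩ := hD.local_epigraph x₀
      (by rw [hD.isOpen.frontier_eq]; exact ⟨hx₀, hx⟩)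
    have h' : IsEpigraphOn D (Metric.ball x₀ r) ν γ := h
    refine ⟨(r / 2) • ν, r / 2, half_pos hr, fun y hy hyr t ht => ?_⟩
    rw [smul_smul]
    have hpos : 0 < t * (r / 2) := mul_pos ht.1 (half_pos hr)
    exact h'.add_smul_mem Metric.isOpen_ball hν hγ.continuous hy
      (Metric.ball_subset_ball (by linarith) hyr) hpos
      (add_smul_mem_ball hν hyr hpos.le (mul_le_of_le_one_left (half_pos hr).le ht.2))

/-! ### The Poincaré inequality up to the boundary. -/

/-- Translation by the inward vector `ν` carries the part of the ball inside `D` into an interior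
ball, where `poincareOn_ball` applies. The error `φ (y + ν) - φ y` is controlled by the gradient
along segments inside `D`. -/
theorem IsLipschitzDomain.exists_poincareOn_ball {D : Set (EuclideanSpace ℝ (Fin d))}
    (hD : IsLipschitzDomain D) {x₀ : EuclideanSpace ℝ (Fin d)} (hx₀ : x₀ ∈ closure D) :
    ∃ ρ > 0, PoincareOn D (Metric.ball x₀ ρ) := by
  obtain ⟨ν, r, hr, hν⟩ := hD.exists_inward_direction hx₀
  have hx₁ : x₀ + ν ∈ D := by
    simpa using hν x₀ hx₀ (Metric.mem_ball_self hr) 1 ⟨one_pos, le_rfl⟩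
  obtain ⟨s, hs, hsD⟩ := Metric.isOpen_iff.1 hD.isOpen _ hx₁
  set ρ := min r (s / 3) with hρ
  have hρ0 : 0 < ρ := lt_min hr (by positivity)
  have hρs : 3 * ρ ≤ s := by linarith [min_le_right r (s / 3)]
  obtain ⟨C, hC⟩ := poincareOn_ball hD.isOpen hρ0 ((Metric.ball_subset_ball hρs).trans hsD)
  refine ⟨ρ, hρ0, 2 * (‖ν‖₊ ^ 2 + C), fun φ hφ => ?_⟩
  obtain ⟨c, hc⟩ := hC φ hφ
  refine ⟨c, ?_⟩
  set I := ∫⁻ x in D, ‖gradient φ x‖ₑ ^ 2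
  have hφc := hφ.continuous
  have hmeas : MeasurableSet (Metric.ball x₀ ρ ∩ D) :=
    measurableSet_ball.inter hD.isOpen.measurableSet
  have hinc : ∫⁻ y in Metric.ball x₀ ρ ∩ D, ‖φ (y + ν) - φ y‖ₑ ^ 2 ≤ ‖ν‖ₑ ^ 2 * I :=
    lintegral_increment_sq_le hφ hD.isOpen.measurableSet hmeas ν fun y hy t ht =>
      hν y (subset_closure hy.2) (Metric.ball_subset_ball (min_le_left _ _) hy.1) t
        ⟨ht.1, ht.2.le⟩
  have hball : Metric.ball (x₀ + ν) ρ ⊆ D :=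
    (Metric.ball_subset_ball (by linarith)).trans hsD
  have htrans : ∫⁻ y in Metric.ball x₀ ρ ∩ D, ‖φ (y + ν) - c‖ₑ ^ 2 ≤ C * I := by
    refine le_trans ?_ hc
    rw [Measure.restrict_restrict measurableSet_ball, Set.inter_eq_left.2 hball,
      ← lintegral_indicator hmeas, ← lintegral_indicator measurableSet_ball,
      ← lintegral_add_right_eq_self ((Metric.ball (x₀ + ν) ρ).indicator _) ν]
    refine lintegral_mono fun y => ?_
    by_cases hy : y ∈ Metric.ball x₀ ρ ∩ D
    · have : y + ν ∈ Metric.ball (x₀ + ν) ρ := by simpa using hy.1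
      rw [Set.indicator_of_mem hy, Set.indicator_of_mem this]
    · simp [hy]
  have hm : Measurable fun y => ‖φ (y + ν) - φ y‖ₑ ^ 2 := by
    have : Continuous fun y => φ (y + ν) - φ y := by fun_prop
    exact this.enorm.measurable.pow_const 2
  have hm' : Measurable fun y => ‖φ (y + ν) - c‖ₑ ^ 2 := by
    have : Continuous fun y => φ (y + ν) - c := by fun_prop
    exact this.enorm.measurable.pow_const 2
  rw [Measure.restrict_restrict measurableSet_ball]
  calc ∫⁻ y in Metric.ball x₀ ρ ∩ D, ‖φ y - c‖ₑ ^ 2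
      ≤ ∫⁻ y in Metric.ball x₀ ρ ∩ D,
          2 * (‖φ (y + ν) - φ y‖ₑ ^ 2 + ‖φ (y + ν) - c‖ₑ ^ 2) := by
        refine lintegral_mono fun y => ?_
        have := enorm_sub_sq_le (φ y) (φ (y + ν)) c
        rwa [← enorm_neg (φ y - φ (y + ν)), neg_sub] at this
    _ = 2 * ((∫⁻ y in Metric.ball x₀ ρ ∩ D, ‖φ (y + ν) - φ y‖ₑ ^ 2) +
          ∫⁻ y in Metric.ball x₀ ρ ∩ D, ‖φ (y + ν) - c‖ₑ ^ 2) := by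
        exact lintegral_two_mul_add hm hm'
    _ ≤ 2 * (‖ν‖ₑ ^ 2 * I + C * I) := by gcongr
    _ = _ := by
        push_cast
        rw [← enorm_eq_nnnorm]
        ring

theorem bulk_ne_zero_of_isOpen {D U : Set (EuclideanSpace ℝ (Fin d))} (hD : IsOpen D)
    (hU : IsOpen U) {x : EuclideanSpace ℝ (Fin d)} (hx : x ∈ closure D) (hxU : x ∈ U) :
    bulk D U ≠ 0 := by
  rw [Measure.restrict_apply hU.measurableSet]
  exact ((hU.inter hD).measure_pos volume (mem_closure_iff.1 hx U hU hxU)).ne'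

/-- The Poincaré inequality on a bounded Lipschitz domain. -/
theorem IsLipschitzDomain.poincare {D : Set (EuclideanSpace ℝ (Fin d))}
    (hD : IsLipschitzDomain D) :
    ∃ C : ℝ≥0, ∀ φ : EuclideanSpace ℝ (Fin d) → ℝ, ContDiff ℝ 1 φ →
      ∃ c : ℝ, ∫⁻ x in D, ‖φ x - c‖ₑ ^ 2 ≤ C * ∫⁻ x in D, ‖gradient φ x‖ₑ ^ 2 := by
  have hDfin : bulk D Set.univ ≠ ⊤ := by simpa using hD.isBounded.measure_lt_top.ne
  have hglue : ∀ {S T : Set (EuclideanSpace ℝ (Fin d))} {x : EuclideanSpace ℝ (Fin d)},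
      IsOpen S → IsOpen T → x ∈ closure D → x ∈ S → x ∈ T → PoincareOn D S → PoincareOn D T →
        PoincareOn D (S ∪ T) := fun hS hT hx hxS hxT =>
    PoincareOn.union hDfin (bulk_ne_zero_of_isOpen hD.isOpen (hS.inter hT) hx ⟨hxS, hxT⟩)
  -- Sharing an open set with a Poincaré inequality is a symmetric, transitive and locally valid
  -- relation, so connectedness extends it to all pairs. Open sets meeting at a point of `closure D`
  -- overlap in positive `bulk D` measure, as gluing requires.
  have hpair : ∀ x ∈ closure D, ∀ y ∈ closure D, ∃ S, IsOpen S ∧ x ∈ S ∧ y ∈ S ∧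
      PoincareOn D S := by
    intro x hx y hy
    refine hD.isConnected.isPreconnected.closure.induction₂
      (fun x y => ∃ S, IsOpen S ∧ x ∈ S ∧ y ∈ S ∧ PoincareOn D S) ?_ ?_ ?_ hx hy
    · intro x hx
      obtain ⟨ρ, hρ, hP⟩ := hD.exists_poincareOn_ball hx
      filter_upwards [mem_nhdsWithin_of_mem_nhds (Metric.ball_mem_nhds x hρ)] with y hy
      exact ⟨_, Metric.isOpen_ball, Metric.mem_ball_self hρ, hy, hP⟩
    · rintro x y z - hy - ⟨S, hS, hxS, hyS, hPS⟩ ⟨T, hT, hyT, hzT, hPT⟩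
      exact ⟨S ∪ T, hS.union hT, Or.inl hxS, Or.inr hzT, hglue hS hT hy hyS hyT hPS hPT⟩
    · rintro x y - - ⟨S, hS, hxS, hyS, hPS⟩
      exact ⟨S, hS, hyS, hxS, hPS⟩
  obtain ⟨x₀, hx₀D⟩ := hD.isConnected.nonempty
  have hx₀ : x₀ ∈ closure D := subset_closure hx₀D
  -- Every set in the compactness argument is made to contain `x₀`, so any two of them can be glued.
  have hcover : ∃ S, IsOpen S ∧ x₀ ∈ S ∧ closure D ⊆ S ∧ PoincareOn D S := by
    refine hD.isBounded.isCompact_closure.induction_on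
      (p := fun K => ∃ S, IsOpen S ∧ x₀ ∈ S ∧ K ⊆ S ∧ PoincareOn D S) ?_ ?_ ?_ ?_
    · obtain ⟨S, hS, h, -, hP⟩ := hpair x₀ hx₀ x₀ hx₀
      exact ⟨S, hS, h, Set.empty_subset _, hP⟩
    · rintro K K' hK ⟨S, hS, h, hK', hP⟩
      exact ⟨S, hS, h, hK.trans hK', hP⟩
    · rintro K K' ⟨S, hS, h, hK, hP⟩ ⟨S', hS', h', hK', hP'⟩
      exact ⟨S ∪ S', hS.union hS', Or.inl h, Set.union_subset_union hK hK',
        hglue hS hS' hx₀ h h' hP hP'⟩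
    · intro x hx
      obtain ⟨S, hS, h, hxS, hP⟩ := hpair x₀ hx₀ x hx
      exact ⟨S, mem_nhdsWithin_of_mem_nhds (hS.mem_nhds hxS), S, hS, h, le_rfl, hP⟩
  obtain ⟨S, hS, -, hDS, C, hC⟩ := hcover
  refine ⟨C, fun φ hφ => ?_⟩
  obtain ⟨c, hc⟩ := hC φ hφ
  rw [Measure.restrict_restrict hS.measurableSet,
    Set.inter_eq_right.2 (subset_closure.trans hDS)] at hc
  exact ⟨c, hc⟩

/-! ### Surface measure on Lipschitz graphs. -/

theorem euclideanHausdorffMeasure_image_le {X Y : Type*} [EMetricSpace X] [MeasurableSpace X]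
    [BorelSpace X] [EMetricSpace Y] [MeasurableSpace Y] [BorelSpace Y] {L : ℝ≥0} {f : X → Y}
    (hf : LipschitzWith L f) (k : ℕ) (s : Set X) :
    Measure.euclideanHausdorffMeasure k (f '' s) ≤
      (L : ℝ≥0∞) ^ k * Measure.euclideanHausdorffMeasure k s := by
  have h := hf.hausdorffMeasure_image_le (Nat.cast_nonneg k) s
  rw [ENNReal.rpow_natCast] at h
  simp only [Measure.euclideanHausdorffMeasure_def, Measure.smul_apply, ENNReal.smul_def,
    smul_eq_mul]
  rw [mul_left_comm]
  gcongr

theorem isAddHaarMeasure_orthogonal {ν : EuclideanSpace ℝ (Fin d)} (hν : ‖ν‖ = 1) :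
    (Measure.euclideanHausdorffMeasure (d - 1) :
      Measure (Submodule.span ℝ {ν})ᗮ).IsAddHaarMeasure := by
  have hν0 : ν ≠ 0 := by rintro rfl; simp at hν
  have h := Submodule.finrank_add_finrank_orthogonal (Submodule.span ℝ {ν})
  rw [finrank_span_singleton hν0, finrank_euclideanSpace_fin] at h
  have h' : Module.finrank ℝ (Submodule.span ℝ {ν})ᗮ = d - 1 := by omega
  rw [← h']
  infer_instance

theorem eq_projection_add_inner_smul {ν : EuclideanSpace ℝ (Fin d)} (hν : ‖ν‖ = 1)
    (y : EuclideanSpace ℝ (Fin d)) :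
    ((Submodule.span ℝ {ν})ᗮ.orthogonalProjectionOnto y : EuclideanSpace ℝ (Fin d)) +
      inner ℝ ν y • ν = y := by
  have h := Submodule.starProjection_add_starProjection_orthogonal
    (K := Submodule.span ℝ {ν}) y
  rw [Submodule.starProjection_unit_singleton ℝ hν, add_comm] at h
  exact h

/-- Coordinates of a point along a unit vector and in the hyperplane orthogonal to it. -/
def hyperplaneCoord {ν : EuclideanSpace ℝ (Fin d)} (hν : ‖ν‖ = 1) :
    ((Submodule.span ℝ {ν})ᗮ × ℝ) ≃L[ℝ] EuclideanSpace ℝ (Fin d) where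
  toFun p := p.1 + p.2 • ν
  map_add' p q := by simp only [Prod.fst_add, Prod.snd_add, Submodule.coe_add, add_smul]; abel
  map_smul' c p := by simp [smul_smul]
  invFun y := ((Submodule.span ℝ {ν})ᗮ.orthogonalProjectionOnto y, inner ℝ ν y)
  left_inv p := by
    have h1 : inner ℝ ν (p.1 : EuclideanSpace ℝ (Fin d)) = 0 :=
      Submodule.mem_orthogonal_singleton_iff_inner_right.1 p.1.2
    ext1
    · simp [projection_add_smul]
    · simp [inner_add_right, inner_smul_right, h1, hν]
  right_inv y := eq_projection_add_inner_smul hν y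
  continuous_toFun := by fun_prop
  continuous_invFun := by fun_prop

/-- The product of Haar measures on hyperplane and line is carried by a linear isomorphism to a Haar
measure, hence to a multiple of Lebesgue measure. The value of `c` plays no role. -/
theorem exists_lintegral_hyperplane_eq {ν : EuclideanSpace ℝ (Fin d)} (hν : ‖ν‖ = 1) :
    ∃ c : ℝ≥0, ∀ f : EuclideanSpace ℝ (Fin d) → ℝ≥0∞, Measurable f →
      ∫⁻ w : (Submodule.span ℝ {ν})ᗮ, (∫⁻ t : ℝ, f (w + t • ν))
        ∂(Measure.euclideanHausdorffMeasure (d - 1)) = c * ∫⁻ x, f x := by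
  have := isAddHaarMeasure_orthogonal hν
  set m : Measure (Submodule.span ℝ {ν})ᗮ := Measure.euclideanHausdorffMeasure (d - 1)
  set e := hyperplaneCoord hν
  have := e.isAddHaarMeasure_map (m.prod volume)
  obtain ⟨c, h⟩ : ∃ c : ℝ≥0, (m.prod volume).map e = c • volume :=
    ⟨_, Measure.isAddLeftInvariant_eq_smul ((m.prod volume).map e) volume⟩
  refine ⟨c, fun f hf => ?_⟩
  have h1 : ∫⁻ x, f x ∂((m.prod volume).map e) = ∫⁻ w, (∫⁻ t : ℝ, f (w + t • ν)) ∂m := by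
    rw [lintegral_map hf e.continuous.measurable, lintegral_prod _ (by fun_prop)]
    rfl
  rw [← h1, h, lintegral_smul_measure]
  simp [ENNReal.smul_def]

section Graph

variable {D U : Set (EuclideanSpace ℝ (Fin d))} {ν : EuclideanSpace ℝ (Fin d)}
  {γ : (Submodule.span ℝ {ν})ᗮ → ℝ} {K : ℝ≥0}

theorem lipschitzWith_graph (hν : ‖ν‖ = 1) (hγ : LipschitzWith K γ) :
    LipschitzWith (1 + K) fun w : (Submodule.span ℝ {ν})ᗮ =>
      (w : EuclideanSpace ℝ (Fin d)) + γ w • ν := by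
  refine (LipschitzWith.subtype_val _).add (LipschitzWith.of_dist_le_mul fun a b => ?_)
  rw [dist_eq_norm, ← sub_smul, norm_smul, hν, mul_one, ← dist_eq_norm]
  exact hγ.dist_le_mul a b

/-- Inside `U` the boundary lies on the graph of `γ`, a `(1 + K)`-Lipschitz image of the hyperplane,
and such a map enlarges the measure by at most the factor `(1 + K) ^ (d - 1)`. -/
theorem IsEpigraphOn.surf_restrict_le (h : IsEpigraphOn D U ν γ) (hU : IsOpen U)
    (hD : IsOpen D) (hν : ‖ν‖ = 1) (hγ : LipschitzWith K γ) :
    (surf D).restrict U ≤ ((1 + K) ^ (d - 1) : ℝ≥0) •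
      (Measure.euclideanHausdorffMeasure (d - 1) : Measure (Submodule.span ℝ {ν})ᗮ).map
        (fun w => w + γ w • ν) := by
  refine Measure.le_intro fun s hs _ => ?_
  have hg := lipschitzWith_graph hν hγ
  rw [Measure.restrict_apply hs, Measure.restrict_apply (hs.inter hU.measurableSet),
    Measure.smul_apply, Measure.map_apply hg.continuous.measurable hs]
  have hsub : s ∩ U ∩ frontier D ⊆ (fun w : (Submodule.span ℝ {ν})ᗮ =>
      (w : EuclideanSpace ℝ (Fin d)) + γ w • ν) ''
        ((fun w : (Submodule.span ℝ {ν})ᗮ => (w : EuclideanSpace ℝ (Fin d)) + γ w • ν) ⁻¹' s) := by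
    rintro y ⟨⟨hys, hyU⟩, hyD⟩
    have hy : ((Submodule.span ℝ {ν})ᗮ.orthogonalProjectionOnto y : EuclideanSpace ℝ (Fin d)) +
        γ ((Submodule.span ℝ {ν})ᗮ.orthogonalProjectionOnto y) • ν = y := by
      rw [h.eq_of_mem_frontier hU hD hγ.continuous hyD hyU]
      exact eq_projection_add_inner_smul hν y
    exact ⟨_, by simpa only [Set.mem_preimage, hy] using hys, hy⟩
  refine (measure_mono hsub).trans ((euclideanHausdorffMeasure_image_le hg _ _).trans_eq ?_)
  rw [ENNReal.smul_def, smul_eq_mul, ENNReal.coe_pow]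

/-- The line through a graph point in direction `ν` is the line through its projection, so a shift
of `t` by `γ w` removes `γ` and Fubini applies. -/
theorem IsEpigraphOn.exists_lintegral_surf_le (h : IsEpigraphOn D U ν γ) (hU : IsOpen U)
    (hD : IsOpen D) (hν : ‖ν‖ = 1) (hγ : LipschitzWith K γ) :
    ∃ C : ℝ≥0, ∀ f : EuclideanSpace ℝ (Fin d) → ℝ≥0∞, Measurable f →
      ∫⁻ y in U, (∫⁻ t : ℝ, f (y + t • ν)) ∂(surf D) ≤ C * ∫⁻ x, f x := by
  obtain ⟨c, hc⟩ := exists_lintegral_hyperplane_eq hν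
  refine ⟨(1 + K) ^ (d - 1) * c, fun f hf => ?_⟩
  refine (lintegral_mono' (h.surf_restrict_le hU hD hν hγ) le_rfl).trans ?_
  rw [lintegral_smul_measure, ENNReal.smul_def, smul_eq_mul, ENNReal.coe_mul, mul_assoc, ← hc f hf]
  gcongr
  refine (lintegral_map_le _ _).trans_eq (lintegral_congr fun w => ?_)
  rw [← lintegral_add_left_eq_self (fun t : ℝ => f (w + t • ν)) (γ w)]
  simp only [add_smul, add_assoc]

end Graph

/-! ### The trace inequality and the total surface measure. -/

/-- Compare `φ y` with `φ (y + t • ν)` for every `t` in the segment, then integrate in `t`. -/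
theorem enorm_sq_le_lintegral_segment {φ : EuclideanSpace ℝ (Fin d) → ℝ} (hφ : ContDiff ℝ 1 φ)
    (y : EuclideanSpace ℝ (Fin d)) {ν : EuclideanSpace ℝ (Fin d)} (hν : ‖ν‖ = 1) {τ : ℝ} :
    ENNReal.ofReal τ * ‖φ y‖ₑ ^ 2 ≤
      2 * ((∫⁻ t in Set.Ioo 0 τ, ‖φ (y + t • ν)‖ₑ ^ 2) +
        ENNReal.ofReal τ ^ 2 * ∫⁻ t in Set.Ioo 0 τ, ‖gradient φ (y + t • ν)‖ₑ ^ 2) := by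
  have hφc := hφ.continuous
  set G := ∫⁻ t in Set.Ioo 0 τ, ‖gradient φ (y + t • ν)‖ₑ ^ 2 with hG
  have hm : Measurable fun t : ℝ => ‖φ (y + t • ν)‖ₑ ^ 2 := by
    have : Continuous fun t : ℝ => φ (y + t • ν) := by fun_prop
    exact this.enorm.measurable.pow_const 2
  have hpt : ∀ t ∈ Set.Ioo 0 τ, ‖φ y‖ₑ ^ 2 ≤
      2 * (‖φ (y + t • ν)‖ₑ ^ 2 + ENNReal.ofReal τ * G) := by
    intro t ht
    have h1 := enorm_increment_sq_le hφ y ν ht.1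
    have hν' : ‖ν‖ₑ = 1 := by rw [← ofReal_norm, hν, ENNReal.ofReal_one]
    rw [hν', one_pow, one_mul] at h1
    have h2 := enorm_sub_sq_le (φ y) (φ (y + t • ν)) 0
    rw [sub_zero, sub_zero, ← enorm_neg (φ y - _), neg_sub, add_comm (‖_‖ₑ ^ 2)] at h2
    refine h2.trans ?_
    gcongr
    refine h1.trans ?_
    gcongr
    · exact ht.2.le
    · exact lintegral_mono_set (Set.Ioo_subset_Ioo_right ht.2.le)
  calc ENNReal.ofReal τ * ‖φ y‖ₑ ^ 2 = ∫⁻ _ in Set.Ioo 0 τ, ‖φ y‖ₑ ^ 2 := by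
        rw [setLIntegral_const, Real.volume_Ioo, sub_zero, mul_comm]
    _ ≤ ∫⁻ t in Set.Ioo 0 τ, 2 * (‖φ (y + t • ν)‖ₑ ^ 2 + ENNReal.ofReal τ * G) :=
        setLIntegral_mono' measurableSet_Ioo hpt
    _ = _ := by
        rw [lintegral_two_mul_add hm measurable_const, setLIntegral_const, Real.volume_Ioo,
          sub_zero]
        ring

/-- The trace inequality near a boundary point. -/
theorem IsLipschitzDomain.exists_local_trace {D : Set (EuclideanSpace ℝ (Fin d))}
    (hD : IsLipschitzDomain D) {x₀ : EuclideanSpace ℝ (Fin d)} (hx₀ : x₀ ∈ frontier D) :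
    ∃ ρ > 0, ∃ C : ℝ≥0, ∀ φ : EuclideanSpace ℝ (Fin d) → ℝ, ContDiff ℝ 1 φ →
      ∫⁻ y in Metric.ball x₀ ρ, ‖φ y‖ₑ ^ 2 ∂(surf D) ≤
        C * ((∫⁻ x in D, ‖φ x‖ₑ ^ 2) + ∫⁻ x in D, ‖gradient φ x‖ₑ ^ 2) := by
  obtain ⟨ν, hν, K, γ, hγ, r, hr, h⟩ := hD.local_epigraph x₀ hx₀
  have h' : IsEpigraphOn D (Metric.ball x₀ r) ν γ := h
  have hsub : Metric.ball x₀ (r / 2) ⊆ Metric.ball x₀ r := Metric.ball_subset_ball (by linarith)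
  have h'' : IsEpigraphOn D (Metric.ball x₀ (r / 2)) ν γ := fun y hy => h y (hsub hy)
  obtain ⟨C, hC⟩ := h''.exists_lintegral_surf_le Metric.isOpen_ball hD.isOpen hν hγ
  set τ := r / 2 with hτ
  have hτ0 : 0 < τ := half_pos hr
  have hDm := hD.isOpen.measurableSet
  -- Segments of length `τ` issuing from boundary points of the half ball lie in `D`, so `f` may be
  -- replaced by its indicator on `D` and integrated over whole lines.
  have hkey : ∀ f : EuclideanSpace ℝ (Fin d) → ℝ≥0∞, Measurable f →
      ∫⁻ y in Metric.ball x₀ τ, (∫⁻ t in Set.Ioo 0 τ, f (y + t • ν)) ∂(surf D) ≤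
        C * ∫⁻ x in D, f x := by
    intro f hf
    rw [← lintegral_indicator hDm]
    refine le_trans ?_ (hC _ (hf.indicator hDm))
    rw [Measure.restrict_restrict measurableSet_ball]
    refine setLIntegral_mono' (measurableSet_ball.inter isClosed_frontier.measurableSet)
      fun y hy => ?_
    rw [← lintegral_indicator measurableSet_Ioo]
    refine lintegral_mono fun t => ?_
    by_cases ht : t ∈ Set.Ioo 0 τ
    · have hmem : y + t • ν ∈ D := h'.add_smul_mem Metric.isOpen_ball hν hγ.continuous
        (frontier_subset_closure hy.2) (hsub hy.1) ht.1
        (add_smul_mem_ball hν hy.1 ht.1.le ht.2.le)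
      rw [Set.indicator_of_mem ht, Set.indicator_of_mem hmem]
    · rw [Set.indicator_of_notMem ht]
      positivity
  refine ⟨τ, hτ0, (τ.toNNReal)⁻¹ * (2 * ((1 + τ.toNNReal ^ 2) * C)), fun φ hφ => ?_⟩
  have hφc := hφ.continuous
  have hm1 : Measurable fun x => ‖φ x‖ₑ ^ 2 := hφc.enorm.measurable.pow_const 2
  have hm2 : Measurable fun x => ‖gradient φ x‖ₑ ^ 2 :=
    (continuous_gradient hφ).enorm.measurable.pow_const 2
  have hmi : ∀ {f : EuclideanSpace ℝ (Fin d) → ℝ≥0∞}, Measurable f →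
      Measurable fun y => ∫⁻ t in Set.Ioo 0 τ, f (y + t • ν) := fun hf =>
    Measurable.lintegral_prod_right' (f := fun p : EuclideanSpace ℝ (Fin d) × ℝ => _)
      (hf.comp (by fun_prop : Measurable fun p : EuclideanSpace ℝ (Fin d) × ℝ => p.1 + p.2 • ν))
  set I₀ := ∫⁻ x in D, ‖φ x‖ₑ ^ 2
  set I₁ := ∫⁻ x in D, ‖gradient φ x‖ₑ ^ 2
  have hmain : ENNReal.ofReal τ * ∫⁻ y in Metric.ball x₀ τ, ‖φ y‖ₑ ^ 2 ∂(surf D) ≤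
      2 * (C * I₀ + ENNReal.ofReal τ ^ 2 * (C * I₁)) := by
    rw [← lintegral_const_mul _ hm1]
    refine (lintegral_mono fun y => enorm_sq_le_lintegral_segment hφ y hν).trans ?_
    rw [lintegral_two_mul_add (hmi hm1) ((hmi hm2).const_mul _), lintegral_const_mul _ (hmi hm2)]
    gcongr
    · exact hkey _ hm1
    · exact hkey _ hm2
  have hτne : ENNReal.ofReal τ ≠ 0 := by simpa using hτ0
  rw [mul_comm, ← ENNReal.le_div_iff_mul_le (Or.inl hτne) (Or.inl ENNReal.ofReal_ne_top)] at hmain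
  refine hmain.trans ?_
  rw [ENNReal.div_eq_inv_mul, ENNReal.coe_mul, ENNReal.coe_inv (by simpa using hτ0), mul_assoc]
  change (ENNReal.ofReal τ)⁻¹ * _ ≤ (ENNReal.ofReal τ)⁻¹ * _
  push_cast
  rw [mul_assoc 2]
  gcongr _ * (2 * ?_)
  change _ ≤ (1 + ENNReal.ofReal τ ^ 2) * C * (I₀ + I₁)
  -- The two cross terms are added so that the bound factors.
  calc C * I₀ + ENNReal.ofReal τ ^ 2 * (C * I₁)
      ≤ (C * I₀ + ENNReal.ofReal τ ^ 2 * (C * I₁)) +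
        (C * I₁ + ENNReal.ofReal τ ^ 2 * (C * I₀)) := le_self_add
    _ = _ := by ring

/-- The trace inequality on a bounded Lipschitz domain. -/
theorem IsLipschitzDomain.trace_inequality {D : Set (EuclideanSpace ℝ (Fin d))}
    (hD : IsLipschitzDomain D) :
    ∃ C : ℝ≥0, ∀ φ : EuclideanSpace ℝ (Fin d) → ℝ, ContDiff ℝ 1 φ →
      ∫⁻ y, ‖φ y‖ₑ ^ 2 ∂(surf D) ≤
        C * ((∫⁻ x in D, ‖φ x‖ₑ ^ 2) + ∫⁻ x in D, ‖gradient φ x‖ₑ ^ 2) := by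
  have hcompact : IsCompact (frontier D) :=
    hD.isBounded.isCompact_closure.of_isClosed_subset isClosed_frontier frontier_subset_closure
  have h : ∃ C : ℝ≥0, ∀ φ : EuclideanSpace ℝ (Fin d) → ℝ, ContDiff ℝ 1 φ →
      ∫⁻ y in frontier D, ‖φ y‖ₑ ^ 2 ∂(surf D) ≤
        C * ((∫⁻ x in D, ‖φ x‖ₑ ^ 2) + ∫⁻ x in D, ‖gradient φ x‖ₑ ^ 2) := by
    refine hcompact.induction_on
      (p := fun S => ∃ C : ℝ≥0, ∀ φ : EuclideanSpace ℝ (Fin d) → ℝ, ContDiff ℝ 1 φ →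
        ∫⁻ y in S, ‖φ y‖ₑ ^ 2 ∂(surf D) ≤
          C * ((∫⁻ x in D, ‖φ x‖ₑ ^ 2) + ∫⁻ x in D, ‖gradient φ x‖ₑ ^ 2)) ?_ ?_ ?_ ?_
    · exact ⟨0, fun φ _ => by simp⟩
    · rintro S T hST ⟨C, hC⟩
      exact ⟨C, fun φ hφ => (lintegral_mono_set hST).trans (hC φ hφ)⟩
    · rintro S T ⟨C, hC⟩ ⟨C', hC'⟩
      refine ⟨C + C', fun φ hφ => (lintegral_union_le _ _ _).trans ?_⟩
      rw [ENNReal.coe_add, add_mul]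
      exact add_le_add (hC φ hφ) (hC' φ hφ)
    · intro x hx
      obtain ⟨ρ, hρ, C, hC⟩ := hD.exists_local_trace hx
      exact ⟨_, mem_nhdsWithin_of_mem_nhds (Metric.ball_mem_nhds x hρ), C, hC⟩
  simpa [Measure.restrict_restrict isClosed_frontier.measurableSet] using h

/-- This is the trace inequality for the constant function `1`. -/
theorem IsLipschitzDomain.surf_univ_lt_top {D : Set (EuclideanSpace ℝ (Fin d))}
    (hD : IsLipschitzDomain D) : surf D Set.univ < ⊤ := by
  obtain ⟨C, hC⟩ := hD.trace_inequality
  have h := hC (fun _ => 1) contDiff_const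
  have hg : gradient (fun _ : EuclideanSpace ℝ (Fin d) => (1 : ℝ)) = 0 := by
    ext1 x
    simp [gradient]
  rw [hg] at h
  simp only [enorm_one, one_pow, lintegral_one, Pi.zero_apply, enorm_zero, ne_eq,
    OfNat.ofNat_ne_zero, not_false_eq_true, zero_pow, lintegral_zero, add_zero] at h
  refine h.trans_lt (ENNReal.mul_lt_top ENNReal.coe_lt_top ?_)
  simpa using hD.isBounded.measure_lt_top

theorem IsLipschitzDomain.frontier_nonempty (hd : 1 ≤ d) {D : Set (EuclideanSpace ℝ (Fin d))}
    (hD : IsLipschitzDomain D) : (frontier D).Nonempty := by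
  have : Nonempty (Fin d) := ⟨⟨0, hd⟩⟩
  have hne : D ≠ Set.univ := by
    intro h
    have := hD.isBounded
    rw [h] at this
    exact NormedSpace.unbounded_univ ℝ (EuclideanSpace ℝ (Fin d)) this
  rw [nonempty_frontier_iff]
  exact ⟨hD.isConnected.nonempty, hne⟩

/-- Orthogonal projection to the hyperplane is 1-Lipschitz, so it does not increase the measure, and
the projected boundary contains a nonempty open subset of the hyperplane. -/
theorem IsLipschitzDomain.surf_univ_pos (hd : 1 ≤ d) {D : Set (EuclideanSpace ℝ (Fin d))}
    (hD : IsLipschitzDomain D) : 0 < surf D Set.univ := by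
  obtain ⟨x₀, hx₀⟩ := hD.frontier_nonempty hd
  obtain ⟨ν, hν, K, γ, hγ, r, hr, h⟩ := hD.local_epigraph x₀ hx₀
  have h' : IsEpigraphOn D (Metric.ball x₀ r) ν γ := h
  have := isAddHaarMeasure_orthogonal hν
  set m : Measure (Submodule.span ℝ {ν})ᗮ := Measure.euclideanHausdorffMeasure (d - 1)
  set P := (Submodule.span ℝ {ν})ᗮ.orthogonalProjectionOnto
  set g : (Submodule.span ℝ {ν})ᗮ → EuclideanSpace ℝ (Fin d) := fun w => w + γ w • ν with hg
  have hgc : Continuous g := (lipschitzWith_graph hν hγ).continuous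
  have hPg : ∀ w, P (g w) = w := fun w => by simp [P, g, projection_add_smul]
  have hin : ∀ w, inner ℝ ν (g w) = γ w := fun w => by
    have h1 : inner ℝ ν (w : EuclideanSpace ℝ (Fin d)) = 0 :=
      Submodule.mem_orthogonal_singleton_iff_inner_right.1 w.2
    simp [g, inner_add_right, inner_smul_right, h1, hν]
  -- A graph point is not in `D`, but the points just above it are.
  have hfr : ∀ w, g w ∈ Metric.ball x₀ r → g w ∈ frontier D := by
    intro w hw
    rw [hD.isOpen.frontier_eq]
    refine ⟨?_, fun hmem => ?_⟩
    · have hc : Tendsto (fun t : ℝ => g w + t • ν) (𝓝[>] 0) (𝓝 (g w)) := by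
        have : Continuous fun t : ℝ => g w + t • ν := by fun_prop
        simpa using (this.tendsto 0).mono_left nhdsWithin_le_nhds
      refine mem_closure_of_tendsto hc ?_
      filter_upwards [hc (Metric.isOpen_ball.mem_nhds hw), self_mem_nhdsWithin] with t ht ht0
      rw [h _ ht, projection_add_smul, inner_add_right, inner_smul_right, hin,
        real_inner_self_eq_norm_sq, hν]
      change γ (P (g w)) < _
      rw [hPg]
      have : 0 < t := ht0
      linarith
    · have := (h _ hw).1 hmem
      change γ (P (g w)) < _ at this
      rw [hPg, hin] at this
      exact lt_irrefl _ this
  have hgx : g (P x₀) = x₀ := by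
    have := h'.eq_of_mem_frontier Metric.isOpen_ball hD.isOpen hγ.continuous hx₀
      (Metric.mem_ball_self hr)
    change (P x₀ : EuclideanSpace ℝ (Fin d)) + γ (P x₀) • ν = x₀
    rw [this]
    exact eq_projection_add_inner_smul hν x₀
  have hpos : 0 < m (g ⁻¹' Metric.ball x₀ r) :=
    (Metric.isOpen_ball.preimage hgc).measure_pos m
      ⟨P x₀, by rw [Set.mem_preimage, hgx]; exact Metric.mem_ball_self hr⟩
  have hsub : g ⁻¹' Metric.ball x₀ r ⊆ P '' frontier D :=
    fun w hw => ⟨g w, hfr w hw, hPg w⟩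
  have hle := euclideanHausdorffMeasure_image_le
    (Submodule.span ℝ {ν})ᗮ.lipschitzWith_orthogonalProjectionOnto (d - 1) (frontier D)
  rw [ENNReal.coe_one, one_pow, one_mul] at hle
  rw [Measure.restrict_apply_univ]
  exact hpos.trans_le ((measure_mono hsub).trans hle)

/-! ### $H^1(\mathcal D)$ as a closed subspace of a Hilbert space. -/

theorem IsLipschitzDomain.isFiniteMeasure_bulk {D : Set (EuclideanSpace ℝ (Fin d))}
    (hD : IsLipschitzDomain D) : IsFiniteMeasure (bulk D) :=
  ⟨by simpa using hD.isBounded.measure_lt_top⟩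

theorem IsLipschitzDomain.isFiniteMeasure_surf {D : Set (EuclideanSpace ℝ (Fin d))}
    (hD : IsLipschitzDomain D) : IsFiniteMeasure (surf D) :=
  ⟨hD.surf_univ_lt_top⟩

theorem memLp_of_continuous {X F : Type*} [TopologicalSpace X] [MeasurableSpace X]
    [OpensMeasurableSpace X] [T2Space X] [NormedAddCommGroup F] [SecondCountableTopology F]
    {f : X → F} (hf : Continuous f) {K : Set X} (hK : IsCompact K) {μ : Measure X}
    [IsFiniteMeasure μ] (hμ : ∀ᵐ x ∂μ, x ∈ K) (p : ℝ≥0∞) : MemLp f p μ := by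
  borelize F
  obtain ⟨C, hC⟩ := hK.exists_bound_of_continuousOn hf.continuousOn
  exact MemLp.of_bound hf.measurable.stronglyMeasurable.aestronglyMeasurable C (hμ.mono hC)

theorem IsLipschitzDomain.memLp_bulk {D : Set (EuclideanSpace ℝ (Fin d))}
    (hD : IsLipschitzDomain D) {F : Type*} [NormedAddCommGroup F] [SecondCountableTopology F]
    {f : EuclideanSpace ℝ (Fin d) → F} (hf : Continuous f) : MemLp f 2 (bulk D) := by
  have := hD.isFiniteMeasure_bulk
  exact memLp_of_continuous hf hD.isBounded.isCompact_closure
    ((ae_restrict_mem hD.isOpen.measurableSet).mono fun x hx => subset_closure hx) 2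

theorem IsLipschitzDomain.memLp_surf {D : Set (EuclideanSpace ℝ (Fin d))}
    (hD : IsLipschitzDomain D) {F : Type*} [NormedAddCommGroup F] [SecondCountableTopology F]
    {f : EuclideanSpace ℝ (Fin d) → F} (hf : Continuous f) : MemLp f 2 (surf D) := by
  have := hD.isFiniteMeasure_surf
  exact memLp_of_continuous hf hD.isBounded.isCompact_closure
    ((ae_restrict_mem isClosed_frontier.measurableSet).mono
      fun x hx => frontier_subset_closure hx) 2

theorem enorm_Lp_two_sq {X F : Type*} [MeasurableSpace X] {μ : Measure X} [NormedAddCommGroup F]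
    (f : Lp F 2 μ) : ‖f‖ₑ ^ 2 = ∫⁻ x, ‖f x‖ₑ ^ 2 ∂μ := by
  have := eLpNorm_nnreal_pow_eq_lintegral (μ := μ) (f := f) (p := 2) (by simp)
  rw [Lp.enorm_def]
  simpa using this

/-- The Hilbert space `L²(D) × L²(D; ℝᵈ) × L²(∂D)` in which `H¹(D)` lives by way of
`u ↦ (u, ∇u, u|∂D)`. -/
abbrev TripleSpace (D : Set (EuclideanSpace ℝ (Fin d))) : Type :=
  WithLp 2 (Lp ℝ 2 (bulk D) ×
    WithLp 2 (Lp (EuclideanSpace ℝ (Fin d)) 2 (bulk D) × Lp ℝ 2 (surf D)))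

section Triple

variable {D : Set (EuclideanSpace ℝ (Fin d))}

variable (D) in
def valL : TripleSpace D →L[ℝ] Lp ℝ 2 (bulk D) := WithLp.fstL 2 ℝ _ _

variable (D) in
def gradL : TripleSpace D →L[ℝ] Lp (EuclideanSpace ℝ (Fin d)) 2 (bulk D) :=
  (WithLp.fstL 2 ℝ _ _).comp (WithLp.sndL 2 ℝ _ _)

variable (D) in
def traceL : TripleSpace D →L[ℝ] Lp ℝ 2 (surf D) :=
  (WithLp.sndL 2 ℝ _ _).comp (WithLp.sndL 2 ℝ _ _)

def mkTriple (f : Lp ℝ 2 (bulk D)) (G : Lp (EuclideanSpace ℝ (Fin d)) 2 (bulk D))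
    (t : Lp ℝ 2 (surf D)) : TripleSpace D :=
  WithLp.toLp 2 (f, WithLp.toLp 2 (G, t))

theorem tendsto_mkTriple {ι : Type*} {l : Filter ι} {f : ι → Lp ℝ 2 (bulk D)}
    {G : ι → Lp (EuclideanSpace ℝ (Fin d)) 2 (bulk D)} {t : ι → Lp ℝ 2 (surf D)}
    {f' : Lp ℝ 2 (bulk D)} {G' : Lp (EuclideanSpace ℝ (Fin d)) 2 (bulk D)}
    {t' : Lp ℝ 2 (surf D)} (hf : Tendsto f l (𝓝 f')) (hG : Tendsto G l (𝓝 G'))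
    (ht : Tendsto t l (𝓝 t')) :
    Tendsto (fun i => mkTriple (f i) (G i) (t i)) l (𝓝 (mkTriple f' G' t')) := by
  have h1 := ((WithLp.prod_continuous_toLp 2 _ _).tendsto (G', t')).comp (hG.prodMk_nhds ht)
  exact ((WithLp.prod_continuous_toLp 2 _ _).tendsto (f', WithLp.toLp 2 (G', t'))).comp
    (hf.prodMk_nhds h1)

theorem norm_sq_triple (z : TripleSpace D) :
    ‖z‖ ^ 2 = ‖valL D z‖ ^ 2 + (‖gradL D z‖ ^ 2 + ‖traceL D z‖ ^ 2) := by
  rw [WithLp.prod_norm_sq_eq_of_L2, WithLp.prod_norm_sq_eq_of_L2]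
  rfl

theorem gradient_add {φ ψ : EuclideanSpace ℝ (Fin d) → ℝ} (hφ : Differentiable ℝ φ)
    (hψ : Differentiable ℝ ψ) (x : EuclideanSpace ℝ (Fin d)) :
    gradient (φ + ψ) x = gradient φ x + gradient ψ x := by
  simp [gradient, fderiv_add hφ.differentiableAt hψ.differentiableAt]

theorem gradient_const_smul {φ : EuclideanSpace ℝ (Fin d) → ℝ} (c : ℝ)
    (x : EuclideanSpace ℝ (Fin d)) : gradient (c • φ) x = c • gradient φ x := by
  simp [gradient, fderiv_const_smul_field]

/-- The triples `(φ, ∇φ, φ|∂D)` of functions `φ` smooth up to the boundary. -/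
structure IsSmoothTriple (z : TripleSpace D) (φ : EuclideanSpace ℝ (Fin d) → ℝ) : Prop where
  contDiff : ContDiff ℝ ∞ φ
  val_eq : valL D z =ᵐ[bulk D] φ
  grad_eq : gradL D z =ᵐ[bulk D] gradient φ
  trace_eq : traceL D z =ᵐ[surf D] φ

theorem IsSmoothTriple.contDiff_one {z : TripleSpace D} {φ : EuclideanSpace ℝ (Fin d) → ℝ}
    (h : IsSmoothTriple z φ) : ContDiff ℝ 1 φ :=
  h.contDiff.of_le (by exact_mod_cast le_top)

theorem IsSmoothTriple.add {z w : TripleSpace D} {φ ψ : EuclideanSpace ℝ (Fin d) → ℝ}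
    (hz : IsSmoothTriple z φ) (hw : IsSmoothTriple w ψ) : IsSmoothTriple (z + w) (φ + ψ) where
  contDiff := hz.contDiff.add hw.contDiff
  val_eq := by
    rw [map_add]
    exact (Lp.coeFn_add _ _).trans (hz.val_eq.add hw.val_eq)
  grad_eq := by
    rw [map_add]
    refine (Lp.coeFn_add _ _).trans ((hz.grad_eq.add hw.grad_eq).trans (.of_forall fun x => ?_))
    exact (gradient_add (hz.contDiff_one.differentiable (by simp))
      (hw.contDiff_one.differentiable (by simp)) x).symm
  trace_eq := by
    rw [map_add]
    exact (Lp.coeFn_add _ _).trans (hz.trace_eq.add hw.trace_eq)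

theorem IsSmoothTriple.smul {z : TripleSpace D} {φ : EuclideanSpace ℝ (Fin d) → ℝ}
    (hz : IsSmoothTriple z φ) (c : ℝ) : IsSmoothTriple (c • z) (c • φ) where
  contDiff := hz.contDiff.const_smul c
  val_eq := by
    rw [map_smul]
    exact (Lp.coeFn_smul _ _).trans (hz.val_eq.const_smul c)
  grad_eq := by
    rw [map_smul]
    refine (Lp.coeFn_smul _ _).trans ((hz.grad_eq.const_smul c).trans (.of_forall fun x => ?_))
    exact (gradient_const_smul c x).symm
  trace_eq := by
    rw [map_smul]
    exact (Lp.coeFn_smul _ _).trans (hz.trace_eq.const_smul c)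

variable (D) in
def smoothTriples : Submodule ℝ (TripleSpace D) where
  carrier := {z | ∃ φ, IsSmoothTriple z φ}
  add_mem' := by
    rintro z w ⟨φ, hφ⟩ ⟨ψ, hψ⟩
    exact ⟨_, hφ.add hψ⟩
  zero_mem' := by
    refine ⟨0, contDiff_const, ?_, ?_, ?_⟩
    · rw [map_zero]
      exact Lp.coeFn_zero _ _ _
    · rw [map_zero]
      refine (Lp.coeFn_zero _ _ _).trans (.of_forall fun x => ?_)
      exact (gradient_const x 0).symm
    · rw [map_zero]
      exact Lp.coeFn_zero _ _ _
  smul_mem' := by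
    rintro c z ⟨φ, hφ⟩
    exact ⟨_, hφ.smul c⟩

variable (D) in
/-- `H¹(D)` as the closure of the smooth functions. -/
def sobolev : Submodule ℝ (TripleSpace D) := (smoothTriples D).topologicalClosure

/-- The triple of a function that is smooth up to the boundary. -/
def IsLipschitzDomain.triple (hD : IsLipschitzDomain D) {φ : EuclideanSpace ℝ (Fin d) → ℝ}
    (hφ : ContDiff ℝ ∞ φ) : TripleSpace D :=
  mkTriple ((hD.memLp_bulk hφ.continuous).toLp φ)
    ((hD.memLp_bulk (continuous_gradient (hφ.of_le (by exact_mod_cast le_top)))).toLp (gradient φ))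
    ((hD.memLp_surf hφ.continuous).toLp φ)

theorem IsLipschitzDomain.isSmoothTriple_triple (hD : IsLipschitzDomain D)
    {φ : EuclideanSpace ℝ (Fin d) → ℝ} (hφ : ContDiff ℝ ∞ φ) :
    IsSmoothTriple (hD.triple hφ) φ :=
  ⟨hφ, MemLp.coeFn_toLp (hD.memLp_bulk hφ.continuous),
    MemLp.coeFn_toLp (hD.memLp_bulk (continuous_gradient (hφ.of_le (by exact_mod_cast le_top)))),
    MemLp.coeFn_toLp (hD.memLp_surf hφ.continuous)⟩

/-- The constant function `1`. -/
def IsLipschitzDomain.one (hD : IsLipschitzDomain D) : TripleSpace D :=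
  hD.triple (φ := fun _ => 1) contDiff_const

theorem IsLipschitzDomain.isSmoothTriple_one (hD : IsLipschitzDomain D) :
    IsSmoothTriple hD.one fun _ => 1 :=
  hD.isSmoothTriple_triple _

theorem IsLipschitzDomain.gradL_one (hD : IsLipschitzDomain D) : gradL D hD.one = 0 := by
  refine Lp.ext (hD.isSmoothTriple_one.grad_eq.trans (EventuallyEq.trans ?_
    (Lp.coeFn_zero _ _ _).symm))
  exact .of_forall fun x => gradient_const x 1

/-- The integral of the trace over `∂D`. -/
def IsLipschitzDomain.traceIntegral (hD : IsLipschitzDomain D) : TripleSpace D →L[ℝ] ℝ :=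
  (innerSL ℝ (traceL D hD.one)).comp (traceL D)

theorem IsLipschitzDomain.inner_traceL_one (hD : IsLipschitzDomain D) (t : Lp ℝ 2 (surf D)) :
    inner ℝ (traceL D hD.one) t = ∫ x, t x ∂(surf D) := by
  rw [L2.inner_def]
  refine integral_congr_ae (hD.isSmoothTriple_one.trace_eq.mono fun x hx => ?_)
  simp [hx]

theorem IsLipschitzDomain.traceIntegral_apply (hD : IsLipschitzDomain D) (z : TripleSpace D) :
    hD.traceIntegral z = ∫ x, traceL D z x ∂(surf D) :=
  hD.inner_traceL_one _

theorem IsLipschitzDomain.traceIntegral_one_pos (hd : 1 ≤ d) (hD : IsLipschitzDomain D) :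
    0 < hD.traceIntegral hD.one := by
  rw [hD.traceIntegral_apply, integral_congr_ae hD.isSmoothTriple_one.trace_eq]
  simpa [Measure.real] using ENNReal.toReal_pos (hD.surf_univ_pos hd).ne' hD.surf_univ_lt_top.ne

/-- Poincaré's inequality for smooth triples, up to a constant. -/
theorem IsLipschitzDomain.exists_norm_sub_smul_one_le (hD : IsLipschitzDomain D) :
    ∃ C : ℝ≥0, ∀ z ∈ smoothTriples D, ∃ c : ℝ, ‖z - c • hD.one‖ ≤ C * ‖gradL D z‖ := by
  obtain ⟨C₁, h₁⟩ := hD.poincare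
  obtain ⟨C₂, h₂⟩ := hD.trace_inequality
  -- The three summands bound the squared norms of value, gradient and trace in turn.
  refine ⟨NNReal.sqrt (C₁ + (1 + C₂ * (C₁ + 1))), ?_⟩
  rintro z ⟨φ, hφ⟩
  obtain ⟨c, hc⟩ := h₁ φ hφ.contDiff_one
  refine ⟨c, ?_⟩
  set w := z - c • hD.one with hw
  have hgw : gradL D w = gradL D z := by simp [hw, hD.gradL_one]
  obtain ⟨ψ, hwφ, hψ⟩ : ∃ ψ, IsSmoothTriple w ψ ∧ ∀ x, ψ x = φ x - c := by
    refine ⟨φ + (-c) • fun _ => 1, ?_, fun x => by simp [sub_eq_add_neg]⟩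
    rw [hw, sub_eq_add_neg, ← neg_smul]
    exact hφ.add (hD.isSmoothTriple_one.smul (-c))
  have hG : ‖gradL D z‖ₑ ^ 2 = ∫⁻ x in D, ‖gradient φ x‖ₑ ^ 2 := by
    rw [enorm_Lp_two_sq]
    exact lintegral_congr_ae (hφ.grad_eq.mono fun x hx => by simp only [hx])
  have hG' : ‖gradL D z‖ₑ ^ 2 = ∫⁻ x in D, ‖gradient ψ x‖ₑ ^ 2 := by
    rw [← hgw, enorm_Lp_two_sq]
    exact lintegral_congr_ae (hwφ.grad_eq.mono fun x hx => by simp only [hx])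
  have hV : ‖valL D w‖ₑ ^ 2 = ∫⁻ x in D, ‖φ x - c‖ₑ ^ 2 := by
    rw [enorm_Lp_two_sq]
    exact lintegral_congr_ae (hwφ.val_eq.mono fun x hx => by simp only [hx, hψ])
  have hT : ‖traceL D w‖ₑ ^ 2 = ∫⁻ x, ‖φ x - c‖ₑ ^ 2 ∂(surf D) := by
    rw [enorm_Lp_two_sq]
    exact lintegral_congr_ae (hwφ.trace_eq.mono fun x hx => by simp only [hx, hψ])
  have hV' : ‖valL D w‖ₑ ^ 2 ≤ C₁ * ‖gradL D z‖ₑ ^ 2 := by rw [hV, hG]; exact hc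
  have hT' : ‖traceL D w‖ₑ ^ 2 ≤ C₂ * (C₁ * ‖gradL D z‖ₑ ^ 2 + ‖gradL D z‖ₑ ^ 2) := by
    have := h₂ _ hwφ.contDiff_one
    simp only [hψ] at this
    rw [← hG', ← hT, ← hV] at this
    refine this.trans ?_
    gcongr
  simp only [enorm_eq_nnnorm] at hV' hT'
  norm_cast at hV' hT'
  have hV'' : ‖valL D w‖ ^ 2 ≤ C₁ * ‖gradL D z‖ ^ 2 := by exact_mod_cast hV'
  have hT'' : ‖traceL D w‖ ^ 2 ≤ C₂ * (C₁ * ‖gradL D z‖ ^ 2 + ‖gradL D z‖ ^ 2) := by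
    exact_mod_cast hT'
  refine (sq_le_sq₀ (norm_nonneg _) (by positivity)).1 ?_
  rw [norm_sq_triple, hgw, mul_pow, Real.coe_sqrt, Real.sq_sqrt (by positivity)]
  push_cast
  linarith

/-- Poincaré's inequality in `H¹(D)` for functions of zero mean on the boundary. -/
theorem IsLipschitzDomain.exists_norm_le_gradL (hd : 1 ≤ d) (hD : IsLipschitzDomain D) :
    ∃ C : ℝ, 0 < C ∧ ∀ z ∈ sobolev D, hD.traceIntegral z = 0 → ‖z‖ ≤ C * ‖gradL D z‖ := by
  obtain ⟨C, hC⟩ := hD.exists_norm_sub_smul_one_le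
  set s := hD.traceIntegral hD.one with hs
  have hs0 : 0 < s := hD.traceIntegral_one_pos hd
  set M := ‖hD.traceIntegral‖ * ‖hD.one‖ / s with hM
  have hM0 : 0 ≤ M := by positivity
  -- Smooth approximants of a mean-zero `z` need not have mean zero, so the mean is subtracted
  -- inside the inequality, which then passes to the closure. Subtracting the mean ignores added
  -- constants, so the unknown `c` drops out.
  have hsmooth : ∀ z ∈ smoothTriples D,
      ‖z - (hD.traceIntegral z / s) • hD.one‖ ≤ ((1 + M) * C + 1) * ‖gradL D z‖ := by
    intro z hz
    obtain ⟨c, hc⟩ := hC z hz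
    set w := z - c • hD.one with hw
    have h1 : z - (hD.traceIntegral z / s) • hD.one =
        w - (hD.traceIntegral w / s) • hD.one := by
      have : hD.traceIntegral w / s = hD.traceIntegral z / s - c := by
        rw [hw, map_sub, map_smul, ← hs, smul_eq_mul]
        field_simp
      rw [this, hw, sub_smul]
      abel
    rw [h1]
    calc ‖w - (hD.traceIntegral w / s) • hD.one‖
        ≤ ‖w‖ + ‖(hD.traceIntegral w / s) • hD.one‖ := norm_sub_le _ _
      _ ≤ ‖w‖ + M * ‖w‖ := by
          gcongr
          rw [norm_smul, norm_div, Real.norm_of_nonneg hs0.le]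
          calc ‖hD.traceIntegral w‖ / s * ‖hD.one‖
              ≤ ‖hD.traceIntegral‖ * ‖w‖ / s * ‖hD.one‖ := by
                gcongr
                exact hD.traceIntegral.le_opNorm w
            _ = M * ‖w‖ := by rw [hM]; ring
      _ = (1 + M) * ‖w‖ := by ring
      _ ≤ (1 + M) * (C * ‖gradL D z‖) := by gcongr
      _ ≤ _ := by nlinarith [norm_nonneg (gradL D z)]
  -- The `+ 1` makes the constant strictly positive.
  refine ⟨(1 + M) * C + 1, by positivity, fun z hz hz0 => ?_⟩
  have hcl : IsClosed {z : TripleSpace D | ‖z - (hD.traceIntegral z / s) • hD.one‖ ≤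
      ((1 + M) * C + 1) * ‖gradL D z‖} := isClosed_le (by fun_prop) (by fun_prop)
  have h := hcl.closure_subset_iff.2 hsmooth hz
  simpa [hz0] using h

end Triple

/-! ### The energy form of a coefficient field. -/

theorem bilin_eq_sum (M : Matrix (Fin d) (Fin d) ℝ) (ξ η : EuclideanSpace ℝ (Fin d)) :
    bilin M ξ η = ∑ i, ξ i * ∑ j, M i j * η j := rfl

theorem bilin_add_left (M : Matrix (Fin d) (Fin d) ℝ) (ξ ξ' η : EuclideanSpace ℝ (Fin d)) :
    bilin M (ξ + ξ') η = bilin M ξ η + bilin M ξ' η := by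
  simp [bilin, add_dotProduct]

theorem bilin_add_right (M : Matrix (Fin d) (Fin d) ℝ) (ξ η η' : EuclideanSpace ℝ (Fin d)) :
    bilin M ξ (η + η') = bilin M ξ η + bilin M ξ η' := by
  simp [bilin, Matrix.mulVec_add, dotProduct_add]

theorem bilin_smul_left (M : Matrix (Fin d) (Fin d) ℝ) (c : ℝ)
    (ξ η : EuclideanSpace ℝ (Fin d)) : bilin M (c • ξ) η = c * bilin M ξ η := by
  simp [bilin, smul_dotProduct]

theorem bilin_smul_right (M : Matrix (Fin d) (Fin d) ℝ) (c : ℝ)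
    (ξ η : EuclideanSpace ℝ (Fin d)) : bilin M ξ (c • η) = c * bilin M ξ η := by
  simp [bilin, Matrix.mulVec_smul, dotProduct_smul]

theorem bilin_sub_matrix (M N : Matrix (Fin d) (Fin d) ℝ) (ξ η : EuclideanSpace ℝ (Fin d)) :
    bilin (M - N) ξ η = bilin M ξ η - bilin N ξ η := by
  simp [bilin, Matrix.sub_mulVec, dotProduct_sub]

theorem bilin_comm {M : Matrix (Fin d) (Fin d) ℝ} (hM : M.IsSymm)
    (ξ η : EuclideanSpace ℝ (Fin d)) : bilin M ξ η = bilin M η ξ := by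
  rw [bilin, Matrix.dotProduct_mulVec, ← Matrix.mulVec_transpose, hM.eq, dotProduct_comm]
  rfl

/-- `A` is a measurable coefficient field on `D` with values in `S_{α,β}`. -/
structure IsCoeffField (D : Set (EuclideanSpace ℝ (Fin d))) (α β : ℝ)
    (A : EuclideanSpace ℝ (Fin d) → Matrix (Fin d) (Fin d) ℝ) : Prop where
  aemeasurable : ∀ i j, AEMeasurable (fun x => A x i j) (bulk D)
  mem_coeffSet : ∀ᵐ x ∂(bulk D), A x ∈ coeffSet d α β

section Form

variable {D : Set (EuclideanSpace ℝ (Fin d))} {α β : ℝ}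
  {A : EuclideanSpace ℝ (Fin d) → Matrix (Fin d) (Fin d) ℝ}

theorem integral_norm_mul_norm_le {X F : Type*} [MeasurableSpace X] {μ : Measure X}
    [NormedAddCommGroup F] (G H : Lp F 2 μ) : ∫ x, ‖G x‖ * ‖H x‖ ∂μ ≤ ‖G‖ * ‖H‖ := by
  set G' : Lp ℝ 2 μ := (Lp.memLp G).norm.toLp _
  set H' : Lp ℝ 2 μ := (Lp.memLp H).norm.toLp _
  have hG : ‖G'‖ = ‖G‖ := by rw [Lp.norm_toLp, eLpNorm_norm, Lp.norm_def]
  have hH : ‖H'‖ = ‖H‖ := by rw [Lp.norm_toLp, eLpNorm_norm, Lp.norm_def]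
  have h : inner ℝ G' H' = ∫ x, ‖G x‖ * ‖H x‖ ∂μ := by
    rw [L2.inner_def]
    refine integral_congr_ae ?_
    filter_upwards [(Lp.memLp G).norm.coeFn_toLp, (Lp.memLp H).norm.coeFn_toLp] with x h1 h2
    rw [h1, h2]
    simp [mul_comm]
  rw [← h, ← hG, ← hH]
  exact real_inner_le_norm _ _

theorem integrable_bilin (hA : ∀ i j, AEMeasurable (fun x => A x i j) (bulk D)) {b : ℝ}
    (hb : ∀ᵐ x ∂(bulk D), ∀ ξ η : EuclideanSpace ℝ (Fin d), |bilin (A x) ξ η| ≤ b * ‖ξ‖ * ‖η‖)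
    (G H : Lp (EuclideanSpace ℝ (Fin d)) 2 (bulk D)) :
    Integrable (fun x => bilin (A x) (G x) (H x)) (bulk D) := by
  have hG : ∀ i, AEMeasurable (fun x => G x i) (bulk D) := fun i =>
    (EuclideanSpace.proj i : EuclideanSpace ℝ (Fin d) →L[ℝ] ℝ).measurable.comp_aemeasurable
      (Lp.aestronglyMeasurable G).aemeasurable
  have hH : ∀ i, AEMeasurable (fun x => H x i) (bulk D) := fun i =>
    (EuclideanSpace.proj i : EuclideanSpace ℝ (Fin d) →L[ℝ] ℝ).measurable.comp_aemeasurable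
      (Lp.aestronglyMeasurable H).aemeasurable
  have hm : AEMeasurable (fun x => bilin (A x) (G x) (H x)) (bulk D) := by
    simp only [bilin_eq_sum]
    exact Finset.aemeasurable_fun_sum _ fun i _ => (hG i).mul
      (Finset.aemeasurable_fun_sum _ fun j _ => (hA i j).mul (hH j))
  refine Integrable.mono' (((Lp.memLp G).norm.integrable_mul (Lp.memLp H).norm).const_mul b)
    hm.aestronglyMeasurable ?_
  filter_upwards [hb] with x hx
  simpa [mul_assoc] using hx (G x) (H x)

/-- The bound `b` is left free because the estimate is also applied to a difference of two
coefficient matrices. -/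
theorem abs_integral_bilin_le (hA : ∀ i j, AEMeasurable (fun x => A x i j) (bulk D)) {b : ℝ}
    (hb0 : 0 ≤ b)
    (hb : ∀ᵐ x ∂(bulk D), ∀ ξ η : EuclideanSpace ℝ (Fin d), |bilin (A x) ξ η| ≤ b * ‖ξ‖ * ‖η‖)
    (G H : Lp (EuclideanSpace ℝ (Fin d)) 2 (bulk D)) :
    |∫ x in D, bilin (A x) (G x) (H x)| ≤ b * ‖G‖ * ‖H‖ := by
  calc |∫ x in D, bilin (A x) (G x) (H x)|
      ≤ ∫ x in D, |bilin (A x) (G x) (H x)| := abs_integral_le_integral_abs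
    _ ≤ ∫ x in D, b * (‖G x‖ * ‖H x‖) := by
        refine integral_mono_ae (integrable_bilin hA hb G H).abs
          (((Lp.memLp G).norm.integrable_mul (Lp.memLp H).norm).const_mul b) ?_
        filter_upwards [hb] with x hx
        simpa [mul_assoc] using hx (G x) (H x)
    _ = b * ∫ x in D, ‖G x‖ * ‖H x‖ := integral_const_mul _ _
    _ ≤ b * (‖G‖ * ‖H‖) := by
        gcongr
        exact integral_norm_mul_norm_le G H
    _ = _ := by ring

theorem IsCoeffField.bound (hA : IsCoeffField D α β A) :
    ∀ᵐ x ∂(bulk D), ∀ ξ η : EuclideanSpace ℝ (Fin d), |bilin (A x) ξ η| ≤ β * ‖ξ‖ * ‖η‖ :=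
  hA.mem_coeffSet.mono fun _ hx => hx.2.2

/-- The bilinear form `(G, H) ↦ ∫_D Gᵀ A H` on `L²(D; ℝᵈ)`. -/
def IsCoeffField.form (hA : IsCoeffField D α β A) (hβ : 0 < β) :
    Lp (EuclideanSpace ℝ (Fin d)) 2 (bulk D) →L[ℝ]
      Lp (EuclideanSpace ℝ (Fin d)) 2 (bulk D) →L[ℝ] ℝ :=
  LinearMap.mkContinuous₂
    (LinearMap.mk₂ ℝ (fun G H : Lp (EuclideanSpace ℝ (Fin d)) 2 (bulk D) =>
        ∫ x in D, bilin (A x) (G x) (H x))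
      (fun G G' H => by
        rw [← integral_add (integrable_bilin hA.aemeasurable hA.bound G H)
          (integrable_bilin hA.aemeasurable hA.bound G' H)]
        refine integral_congr_ae ((Lp.coeFn_add G G').mono fun x hx => ?_)
        simp only [hx, Pi.add_apply, bilin_add_left])
      (fun c G H => by
        rw [smul_eq_mul, ← integral_const_mul]
        refine integral_congr_ae ((Lp.coeFn_smul c G).mono fun x hx => ?_)
        simp only [hx, Pi.smul_apply, bilin_smul_left])
      (fun G H H' => by
        rw [← integral_add (integrable_bilin hA.aemeasurable hA.bound G H)
          (integrable_bilin hA.aemeasurable hA.bound G H')]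
        refine integral_congr_ae ((Lp.coeFn_add H H').mono fun x hx => ?_)
        simp only [hx, Pi.add_apply, bilin_add_right])
      (fun c G H => by
        rw [smul_eq_mul, ← integral_const_mul]
        refine integral_congr_ae ((Lp.coeFn_smul c H).mono fun x hx => ?_)
        simp only [hx, Pi.smul_apply, bilin_smul_right]))
    β (fun G H => abs_integral_bilin_le hA.aemeasurable hβ.le hA.bound G H)

theorem IsCoeffField.form_apply (hA : IsCoeffField D α β A) (hβ : 0 < β)
    (G H : Lp (EuclideanSpace ℝ (Fin d)) 2 (bulk D)) :
    hA.form hβ G H = ∫ x in D, bilin (A x) (G x) (H x) := rfl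

theorem IsCoeffField.form_comm (hA : IsCoeffField D α β A) (hβ : 0 < β)
    (G H : Lp (EuclideanSpace ℝ (Fin d)) 2 (bulk D)) : hA.form hβ G H = hA.form hβ H G :=
  integral_congr_ae (hA.mem_coeffSet.mono fun _ hx => bilin_comm hx.1 _ _)

theorem IsCoeffField.le_form (hA : IsCoeffField D α β A) (hβ : 0 < β)
    (G : Lp (EuclideanSpace ℝ (Fin d)) 2 (bulk D)) : α * ‖G‖ ^ 2 ≤ hA.form hβ G G := by
  have h : ‖G‖ ^ 2 = ∫ x in D, ‖G x‖ ^ 2 := by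
    rw [← real_inner_self_eq_norm_sq, L2.inner_def]
    simp only [real_inner_self_eq_norm_sq]
  rw [h, ← integral_const_mul, hA.form_apply]
  refine integral_mono_ae ((Lp.memLp G).norm.integrable_sq.const_mul α)
    (integrable_bilin hA.aemeasurable hA.bound G G) ?_
  filter_upwards [hA.mem_coeffSet] with x hx using hx.2.1 _

end Form

/-! ### Dictionary between `H1 D` and `sobolev D`. -/

section Correspondence

variable {D : Set (EuclideanSpace ℝ (Fin d))}

/-- The element of `L²(D) × L²(D; ℝᵈ) × L²(∂D)` given by a function in `H¹(D)`. -/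
def H1.toTriple (u : H1 D) : TripleSpace D :=
  mkTriple (u.memLp_toFun.toLp _) (u.memLp_grad.toLp _) (u.memLp_trace.toLp _)

theorem H1.val_toTriple (u : H1 D) : valL D u.toTriple =ᵐ[bulk D] u.toFun :=
  u.memLp_toFun.coeFn_toLp

theorem H1.grad_toTriple (u : H1 D) : gradL D u.toTriple =ᵐ[bulk D] u.grad :=
  u.memLp_grad.coeFn_toLp

theorem H1.trace_toTriple (u : H1 D) : traceL D u.toTriple =ᵐ[surf D] u.trace :=
  u.memLp_trace.coeFn_toLp

/-- The sequence in `IsTrace` converges in all three components at once. -/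
theorem IsLipschitzDomain.toTriple_mem_sobolev (hD : IsLipschitzDomain D) (u : H1 D) :
    u.toTriple ∈ sobolev D := by
  obtain ⟨φ, hφ, h1, h2, h3⟩ := u.isTrace
  refine mem_closure_of_tendsto (f := fun n => hD.triple (hφ n)) (b := atTop) ?_
    (.of_forall fun n => ⟨φ n, hD.isSmoothTriple_triple (hφ n)⟩)
  refine tendsto_mkTriple ?_ ?_ ?_
  · exact (Lp.tendsto_Lp_iff_tendsto_eLpNorm'' _ _ _ _).2 h1
  · exact (Lp.tendsto_Lp_iff_tendsto_eLpNorm'' _ _ _ _).2 h2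
  · exact (Lp.tendsto_Lp_iff_tendsto_eLpNorm'' _ _ _ _).2 h3

theorem integral_mul_gradient_eq_neg {φ ψ : EuclideanSpace ℝ (Fin d) → ℝ} (hφ : ContDiff ℝ ∞ φ)
    (hψ : ContDiff ℝ ∞ ψ) (hc : HasCompactSupport ψ) (hψD : tsupport ψ ⊆ D) (i : Fin d) :
    ∫ x in D, φ x * gradient ψ x i = -∫ x in D, gradient φ x i * ψ x := by
  have hco : ∀ (f : EuclideanSpace ℝ (Fin d) → ℝ) (x : EuclideanSpace ℝ (Fin d)),
      gradient f x i = fderiv ℝ f x (EuclideanSpace.single i 1) := by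
    intro f x
    rw [← inner_gradient, EuclideanSpace.inner_single_right]
    simp
  simp only [hco]
  have hφ1 : Continuous fun x => fderiv ℝ φ x (EuclideanSpace.single i 1) :=
    (hφ.continuous_fderiv (by simp)).clm_apply continuous_const
  have hψ1 : Continuous fun x => fderiv ℝ ψ x (EuclideanSpace.single i 1) :=
    (hψ.continuous_fderiv (by simp)).clm_apply continuous_const
  have hc1 : HasCompactSupport fun x => fderiv ℝ ψ x (EuclideanSpace.single i 1) :=
    hc.fderiv_apply ℝ _
  have hs1 : ∀ x ∉ D, φ x * fderiv ℝ ψ x (EuclideanSpace.single i 1) = 0 := by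
    intro x hx
    have : fderiv ℝ ψ x = 0 := by
      by_contra h
      exact hx (hψD (support_fderiv_subset ℝ h))
    simp [this]
  have hs2 : ∀ x ∉ D, fderiv ℝ φ x (EuclideanSpace.single i 1) * ψ x = 0 := by
    intro x hx
    rw [image_eq_zero_of_notMem_tsupport fun h => hx (hψD h), mul_zero]
  rw [setIntegral_eq_integral_of_forall_compl_eq_zero hs1,
    setIntegral_eq_integral_of_forall_compl_eq_zero hs2]
  refine integral_mul_fderiv_eq_neg_fderiv_mul_of_integrable ?_ ?_ ?_ ?_ ?_
  · exact (hφ1.mul hψ.continuous).integrable_of_hasCompactSupport hc.mul_left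
  · exact (hφ.continuous.mul hψ1).integrable_of_hasCompactSupport hc1.mul_left
  · exact (hφ.continuous.mul hψ.continuous).integrable_of_hasCompactSupport hc.mul_left
  · exact fun x _ => hφ.differentiable (by simp) x
  · exact fun x _ => hψ.differentiable (by simp) x

/-- For a fixed test function both sides are inner products with fixed `L²` functions, so the
identity is a closed condition; on smooth triples it is integration by parts. -/
theorem IsLipschitzDomain.hasWeakGradient_of_mem_sobolev (hD : IsLipschitzDomain D)
    {z : TripleSpace D} (hz : z ∈ sobolev D) : HasWeakGradient D (valL D z) (gradL D z) := by
  intro ψ hψ hc hψD i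
  have hψ1 := continuous_gradient (hψ.of_le (by exact_mod_cast le_top) : ContDiff ℝ 1 ψ)
  have hm1 : MemLp (fun x => gradient ψ x i) 2 (bulk D) := hD.memLp_bulk
    ((EuclideanSpace.proj i : EuclideanSpace ℝ (Fin d) →L[ℝ] ℝ).continuous.comp hψ1)
  have hm2 : MemLp (fun x => ψ x • EuclideanSpace.single i (1 : ℝ)) 2 (bulk D) :=
    hD.memLp_bulk (hψ.continuous.smul continuous_const)
  have e1 : ∀ z : TripleSpace D,
      ∫ x in D, valL D z x * gradient ψ x i = inner ℝ (hm1.toLp _) (valL D z) := by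
    intro z
    rw [L2.inner_def]
    refine integral_congr_ae (hm1.coeFn_toLp.mono fun x hx => ?_)
    simp only [hx]
    simp
  have e2 : ∀ z : TripleSpace D,
      ∫ x in D, gradL D z x i * ψ x = inner ℝ (hm2.toLp _) (gradL D z) := by
    intro z
    rw [L2.inner_def]
    refine integral_congr_ae (hm2.coeFn_toLp.mono fun x hx => ?_)
    simp only [hx, inner_smul_left, EuclideanSpace.inner_single_left]
    simp [mul_comm]
  rw [e1, e2]
  have hcl : IsClosed {z : TripleSpace D |
      inner ℝ (hm1.toLp _) (valL D z) = -inner ℝ (hm2.toLp _) (gradL D z)} :=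
    isClosed_eq (by fun_prop) (by fun_prop)
  refine hcl.closure_subset_iff.2 ?_ hz
  rintro w ⟨φ, hφ⟩
  change _ = _
  rw [← e1, ← e2]
  convert integral_mul_gradient_eq_neg hφ.contDiff hψ hc hψD i using 1
  · exact integral_congr_ae (hφ.val_eq.mono fun x hx => by simp only [hx])
  · congr 1
    exact integral_congr_ae (hφ.grad_eq.mono fun x hx => by simp only [hx])

/-- A smooth sequence converging to `z` is itself the witness required by `IsTrace`. -/
theorem IsLipschitzDomain.exists_toTriple_eq (hD : IsLipschitzDomain D)
    {z : TripleSpace D} (hz : z ∈ sobolev D) : ∃ u : H1 D, u.toTriple = z := by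
  have htr : IsTrace D (valL D z) (gradL D z) (traceL D z) := by
    obtain ⟨w, hw, hlim⟩ := mem_closure_iff_seq_limit.1 hz
    choose φ hφ using hw
    refine ⟨φ, fun n => (hφ n).contDiff, ?_, ?_, ?_⟩
    · have h := (Lp.tendsto_Lp_iff_tendsto_eLpNorm' _ _).1 (((valL D).continuous.tendsto z).comp hlim)
      refine h.congr fun n => eLpNorm_congr_ae ?_
      exact (hφ n).val_eq.mono fun x hx => by simp [hx]
    · have h := (Lp.tendsto_Lp_iff_tendsto_eLpNorm' _ _).1
        (((gradL D).continuous.tendsto z).comp hlim)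
      refine h.congr fun n => eLpNorm_congr_ae ?_
      exact (hφ n).grad_eq.mono fun x hx => by simp [hx]
    · have h := (Lp.tendsto_Lp_iff_tendsto_eLpNorm' _ _).1
        (((traceL D).continuous.tendsto z).comp hlim)
      refine h.congr fun n => eLpNorm_congr_ae ?_
      exact (hφ n).trace_eq.mono fun x hx => by simp [hx]
  refine ⟨⟨valL D z, gradL D z, traceL D z, Lp.memLp _, Lp.memLp _, Lp.memLp _,
    hD.hasWeakGradient_of_mem_sobolev hz, htr⟩, ?_⟩
  simp only [H1.toTriple, Lp.toLp_coeFn]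
  rfl

variable {α β : ℝ} {A : EuclideanSpace ℝ (Fin d) → Matrix (Fin d) (Fin d) ℝ}

theorem H1.form_toTriple (hA : IsCoeffField D α β A) (hβ : 0 < β) (v u : H1 D) :
    hA.form hβ (gradL D v.toTriple) (gradL D u.toTriple) =
      ∫ x in D, bilin (A x) (v.grad x) (u.grad x) := by
  rw [hA.form_apply]
  refine integral_congr_ae ?_
  filter_upwards [v.grad_toTriple, u.grad_toTriple] with x h1 h2
  rw [h1, h2]

theorem H1.inner_toTriple (g : Lp ℝ 2 (surf D)) (v : H1 D) :
    inner ℝ g (traceL D v.toTriple) = ∫ x, g x * v.trace x ∂(surf D) := by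
  rw [L2.inner_def]
  refine integral_congr_ae (v.trace_toTriple.mono fun x hx => ?_)
  simp only [hx]
  simp [mul_comm]

theorem IsLipschitzDomain.isNeumannSolution_iff (hD : IsLipschitzDomain D)
    (hA : IsCoeffField D α β A) (hβ : 0 < β) (g : Lp ℝ 2 (surf D)) (u : H1 D) :
    IsNeumannSolution D A g u ↔ hD.traceIntegral u.toTriple = 0 ∧
      ∀ v ∈ sobolev D, hA.form hβ (gradL D v) (gradL D u.toTriple) = inner ℝ g (traceL D v) := by
  have h : hD.traceIntegral u.toTriple = ∫ x, u.trace x ∂(surf D) := by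
    rw [hD.traceIntegral_apply]
    exact integral_congr_ae u.trace_toTriple
  rw [IsNeumannSolution, h]
  refine and_congr_right fun _ => ⟨fun H v hv => ?_, fun H v => ?_⟩
  · obtain ⟨v, rfl⟩ := hD.exists_toTriple_eq hv
    rw [H1.form_toTriple, H1.inner_toTriple, H v]
  · rw [← H1.form_toTriple hA hβ, ← H1.inner_toTriple, H _ (hD.toTriple_mem_sobolev v)]

end Correspondence

/-! ### Existence and uniqueness for the Neumann problem. -/

section WellPosedness

variable {D : Set (EuclideanSpace ℝ (Fin d))} {α β : ℝ}
  {A : EuclideanSpace ℝ (Fin d) → Matrix (Fin d) (Fin d) ℝ}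

/-- `H¹_m(D)`: functions in `H¹(D)` with zero mean on `∂D`. -/
def IsLipschitzDomain.meanZero (hD : IsLipschitzDomain D) : Submodule ℝ (TripleSpace D) :=
  sobolev D ⊓ hD.traceIntegral.ker

theorem IsLipschitzDomain.isClosed_meanZero (hD : IsLipschitzDomain D) :
    IsClosed (hD.meanZero : Set (TripleSpace D)) :=
  (smoothTriples D).isClosed_topologicalClosure.inter hD.traceIntegral.isClosed_ker

theorem IsLipschitzDomain.inner_traceL_one_eq_zero (hD : IsLipschitzDomain D)
    {g : Lp ℝ 2 (surf D)} (hg : g ∈ L2m D) : inner ℝ g (traceL D hD.one) = 0 := by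
  rw [real_inner_comm, hD.inner_traceL_one]
  exact hg

/-- The Lax–Milgram theorem on a closed subspace, for a form pulled back along `T`. -/
theorem exists_mem_forall_eq_of_coercive {X Y : Type*} [NormedAddCommGroup X]
    [InnerProductSpace ℝ X] [CompleteSpace X] [NormedAddCommGroup Y] [NormedSpace ℝ Y]
    {S : Submodule ℝ X} (hS : IsClosed (S : Set X)) (T : X →L[ℝ] Y) (b : Y →L[ℝ] Y →L[ℝ] ℝ)
    (ℓ : X →L[ℝ] ℝ) {c : ℝ} (hc : 0 < c) (h : ∀ u ∈ S, c * ‖u‖ * ‖u‖ ≤ b (T u) (T u)) :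
    ∃ u ∈ S, ∀ v ∈ S, b (T u) (T v) = ℓ v := by
  have : CompleteSpace S := hS.completeSpace_coe
  have hB : IsCoercive (b.bilinearComp (T.comp S.subtypeL) (T.comp S.subtypeL)) :=
    ⟨c, hc, fun u => h u u.2⟩
  have hu := fun v => hB.continuousLinearEquivOfBilin_apply
    (hB.continuousLinearEquivOfBilin.symm
      ((InnerProductSpace.toDual ℝ S).symm (ℓ.comp S.subtypeL))) v
  simp only [ContinuousLinearEquiv.apply_symm_apply, InnerProductSpace.toDual_symm_apply] at hu
  exact ⟨_, Subtype.property _, fun v hv => (hu ⟨v, hv⟩).symm⟩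

theorem IsLipschitzDomain.exists_meanZero_solution (hd : 1 ≤ d) (hD : IsLipschitzDomain D)
    (hα : 0 < α) (hβ : 0 < β) (hA : IsCoeffField D α β A) (g : Lp ℝ 2 (surf D)) :
    ∃ u ∈ hD.meanZero, ∀ v ∈ hD.meanZero,
      hA.form hβ (gradL D u) (gradL D v) = inner ℝ g (traceL D v) := by
  obtain ⟨C, hC0, hC⟩ := hD.exists_norm_le_gradL hd
  have hcoer : ∀ u ∈ hD.meanZero, α / C ^ 2 * ‖u‖ * ‖u‖ ≤ hA.form hβ (gradL D u) (gradL D u) := by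
    intro u hu
    have h1 : ‖u‖ ≤ C * ‖gradL D u‖ := hC u hu.1 hu.2
    calc α / C ^ 2 * ‖u‖ * ‖u‖ ≤ α / C ^ 2 * (C * ‖gradL D u‖) * (C * ‖gradL D u‖) := by gcongr
      _ = α * ‖gradL D u‖ ^ 2 := by field_simp
      _ ≤ _ := hA.le_form hβ (gradL D u)
  exact exists_mem_forall_eq_of_coercive hD.isClosed_meanZero (gradL D) (hA.form hβ)
    ((innerSL ℝ g).comp (traceL D)) (by positivity) hcoer

/-- Lax–Milgram only tests against mean-zero functions. Subtracting a constant from a general `v`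
leaves both sides unchanged: its gradient vanishes, and `g` is orthogonal to constants. -/
theorem IsLipschitzDomain.exists_solution (hd : 1 ≤ d) (hD : IsLipschitzDomain D) (hα : 0 < α)
    (hβ : 0 < β) (hA : IsCoeffField D α β A) {g : Lp ℝ 2 (surf D)} (hg : g ∈ L2m D) :
    ∃ u : H1 D, IsNeumannSolution D A g u := by
  obtain ⟨u, hu, hweak⟩ := hD.exists_meanZero_solution hd hα hβ hA g
  obtain ⟨w, hw⟩ := hD.exists_toTriple_eq hu.1
  refine ⟨w, (hD.isNeumannSolution_iff hA hβ g w).2 ⟨hw ▸ hu.2, fun v hv => ?_⟩⟩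
  set s := hD.traceIntegral hD.one with hs
  have hs0 : s ≠ 0 := (hD.traceIntegral_one_pos hd).ne'
  have hone : hD.one ∈ sobolev D :=
    Submodule.le_topologicalClosure _ ⟨_, hD.isSmoothTriple_one⟩
  have hmem : v - (hD.traceIntegral v / s) • hD.one ∈ hD.meanZero := by
    refine ⟨Submodule.sub_mem _ hv (Submodule.smul_mem _ _ hone), ?_⟩
    change hD.traceIntegral _ = 0
    rw [map_sub, map_smul, ← hs, smul_eq_mul, div_mul_cancel₀ _ hs0, sub_self]
  have h := hweak _ hmem
  simp only [map_sub, map_smul, hD.gradL_one, smul_zero, sub_zero, inner_sub_right,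
    inner_smul_right, hD.inner_traceL_one_eq_zero hg, mul_zero] at h
  rw [hA.form_comm, hw, h]

/-- Testing with the difference of two solutions kills its gradient, and Poincaré then kills the
difference. -/
theorem IsLipschitzDomain.wellPosed (hd : 1 ≤ d) (hD : IsLipschitzDomain D) (hα : 0 < α)
    (hβ : 0 < β) (hA : IsCoeffField D α β A) {g : Lp ℝ 2 (surf D)} (hg : g ∈ L2m D) :
    WellPosed D A g := by
  obtain ⟨C, hC0, hC⟩ := hD.exists_norm_le_gradL hd
  obtain ⟨u, hu⟩ := hD.exists_solution hd hα hβ hA hg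
  refine ⟨u, hu, fun w hw => ?_⟩
  obtain ⟨hu0, hu⟩ := (hD.isNeumannSolution_iff hA hβ g u).1 hu
  obtain ⟨hw0, hw⟩ := (hD.isNeumannSolution_iff hA hβ g w).1 hw
  have hz : w.toTriple - u.toTriple ∈ sobolev D :=
    Submodule.sub_mem _ (hD.toTriple_mem_sobolev w) (hD.toTriple_mem_sobolev u)
  have hform : hA.form hβ (gradL D (w.toTriple - u.toTriple))
      (gradL D (w.toTriple - u.toTriple)) = 0 := by
    conv_lhs => enter [2]; rw [map_sub]
    rw [map_sub, hu _ hz, hw _ hz, sub_self]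
  have hgrad : ‖gradL D (w.toTriple - u.toTriple)‖ = 0 := by
    have h := hA.le_form hβ (gradL D (w.toTriple - u.toTriple))
    rw [hform] at h
    by_contra hne
    have : 0 < ‖gradL D (w.toTriple - u.toTriple)‖ := lt_of_le_of_ne (norm_nonneg _) (Ne.symm hne)
    have : 0 < α * ‖gradL D (w.toTriple - u.toTriple)‖ ^ 2 := by positivity
    linarith
  have hnorm := hC _ hz (by rw [map_sub, hu0, hw0, sub_self])
  rw [hgrad, mul_zero] at hnorm
  have heq : w.toTriple = u.toTriple := sub_eq_zero.1 (norm_le_zero_iff.1 hnorm)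
  refine w.val_toTriple.symm.trans ?_
  rw [heq]
  exact u.val_toTriple

end WellPosedness

/-! ### Compactness of the coefficient set. -/

section Coefficients

variable {D : Set (EuclideanSpace ℝ (Fin d))} {α β : ℝ}

theorem isCoeffField_const {M : Matrix (Fin d) (Fin d) ℝ} (hM : M ∈ coeffSet d α β) :
    IsCoeffField D α β fun _ => M :=
  ⟨fun _ _ => aemeasurable_const, .of_forall fun _ => hM⟩

/-- Dilations pull null sets back to null sets, so almost everywhere properties survive rescaling.
-/
theorem IsPeriodicCoeff.isCoeffField_rescale
    {Aper : EuclideanSpace ℝ (Fin d) → Matrix (Fin d) (Fin d) ℝ} (hA : IsPeriodicCoeff α β Aper)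
    {ε : ℝ} (hε : 0 < ε) : IsCoeffField D α β (rescale Aper ε) := by
  have hq : Measure.QuasiMeasurePreserving (fun x : EuclideanSpace ℝ (Fin d) => ε⁻¹ • x)
      volume volume := by
    refine ⟨measurable_const_smul _, ?_⟩
    rw [Measure.map_addHaar_smul volume (inv_ne_zero hε.ne')]
    exact Measure.smul_absolutelyContinuous
  refine ⟨fun i j => ?_, ?_⟩
  · exact ((hA.aemeasurable i j).comp_quasiMeasurePreserving hq).mono_measure
      Measure.restrict_le_self
  · exact ae_restrict_of_ae (hq.ae hA.mem_coeffSet)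

/-- For `d ≥ 1` and positive `α`, `β` nonemptiness means `α ≤ β`; here this comes from the existence
of `Aper`. -/
theorem IsPeriodicCoeff.coeffSet_nonempty
    {Aper : EuclideanSpace ℝ (Fin d) → Matrix (Fin d) (Fin d) ℝ}
    (hA : IsPeriodicCoeff α β Aper) : (coeffSet d α β).Nonempty :=
  let ⟨x, hx⟩ := hA.mem_coeffSet.exists
  ⟨Aper x, hx⟩

theorem continuous_bilin (ξ η : EuclideanSpace ℝ (Fin d)) :
    Continuous fun M : Matrix (Fin d) (Fin d) ℝ => bilin M ξ η :=
  continuous_const.dotProduct (continuous_id.matrix_mulVec continuous_const)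

theorem isClosed_coeffSet (d : ℕ) (α β : ℝ) : IsClosed (coeffSet d α β) := by
  have h1 : IsClosed {M : Matrix (Fin d) (Fin d) ℝ | M.IsSymm} :=
    isClosed_eq continuous_id.matrix_transpose continuous_id
  have h2 : IsClosed {M : Matrix (Fin d) (Fin d) ℝ |
      ∀ ξ : EuclideanSpace ℝ (Fin d), α * ‖ξ‖ ^ 2 ≤ bilin M ξ ξ} := by
    simp only [Set.ofPred_forall]
    exact isClosed_iInter fun ξ => isClosed_le continuous_const (continuous_bilin ξ ξ)
  have h3 : IsClosed {M : Matrix (Fin d) (Fin d) ℝ |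
      ∀ ξ η : EuclideanSpace ℝ (Fin d), |bilin M ξ η| ≤ β * ‖ξ‖ * ‖η‖} := by
    simp only [Set.ofPred_forall]
    exact isClosed_iInter fun ξ => isClosed_iInter fun η =>
      isClosed_le (continuous_bilin ξ η).abs continuous_const
  exact h1.inter (h2.inter h3)

theorem abs_entry_le_of_mem_coeffSet {M : Matrix (Fin d) (Fin d) ℝ} (hM : M ∈ coeffSet d α β)
    (i j : Fin d) : |M i j| ≤ β := by
  have h := hM.2.2 (EuclideanSpace.single i 1) (EuclideanSpace.single j 1)
  have h' : bilin M (EuclideanSpace.single i 1) (EuclideanSpace.single j 1) = M i j := by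
    simp [bilin_eq_sum]
  rw [h'] at h
  simpa using h

theorem isCompact_coeffSet (d : ℕ) (α β : ℝ) : IsCompact (coeffSet d α β) := by
  have hK : IsCompact (Set.univ.pi fun _ : Fin d => Set.univ.pi fun _ : Fin d => Set.Icc (-β) β) :=
    isCompact_univ_pi fun _ => isCompact_univ_pi fun _ => isCompact_Icc
  exact hK.of_isClosed_subset (isClosed_coeffSet d α β) fun M hM i _ j _ =>
    abs_le.1 (abs_entry_le_of_mem_coeffSet hM i j)

theorem abs_bilin_le_sum (M : Matrix (Fin d) (Fin d) ℝ) (ξ η : EuclideanSpace ℝ (Fin d)) :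
    |bilin M ξ η| ≤ (∑ i, ∑ j, |M i j|) * ‖ξ‖ * ‖η‖ := by
  rw [bilin_eq_sum]
  calc |∑ i, ξ i * ∑ j, M i j * η j| ≤ ∑ i, ∑ j, |M i j| * ‖ξ‖ * ‖η‖ := by
        refine (Finset.abs_sum_le_sum_abs _ _).trans (Finset.sum_le_sum fun i _ => ?_)
        rw [Finset.mul_sum]
        refine (Finset.abs_sum_le_sum_abs _ _).trans (Finset.sum_le_sum fun j _ => ?_)
        have h1 : |ξ i| ≤ ‖ξ‖ := PiLp.norm_apply_le ξ i
        have h2 : |η j| ≤ ‖η‖ := PiLp.norm_apply_le η j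
        rw [abs_mul, abs_mul]
        calc |ξ i| * (|M i j| * |η j|) ≤ ‖ξ‖ * (|M i j| * ‖η‖) := by gcongr
          _ = _ := by ring
    _ = _ := by simp only [Finset.sum_mul]

end Coefficients

/-! ### Continuity and boundedness of the energy. -/

section Energy

variable {D : Set (EuclideanSpace ℝ (Fin d))} {α β : ℝ}
  {A : EuclideanSpace ℝ (Fin d) → Matrix (Fin d) (Fin d) ℝ}

/-- Test the equation with `v = u`. The solution returned is the one chosen inside `energy`, so
uniqueness is not needed. -/
theorem IsLipschitzDomain.exists_energy_eq (hd : 1 ≤ d) (hD : IsLipschitzDomain D) (hα : 0 < α)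
    (hβ : 0 < β) (hA : IsCoeffField D α β A) {g : Lp ℝ 2 (surf D)} (hg : g ∈ L2m D) :
    ∃ u : H1 D, IsNeumannSolution D A g u ∧
      energy D A g = -(1 / 2) * inner ℝ g (traceL D u.toTriple) := by
  have h := hD.exists_solution hd hα hβ hA hg
  refine ⟨h.choose, h.choose_spec, ?_⟩
  rw [energy, dif_pos h, h.choose_spec.2 h.choose, H1.inner_toTriple]
  ring

theorem norm_traceL_le (z : TripleSpace D) : ‖traceL D z‖ ≤ ‖z‖ := by
  refine (sq_le_sq₀ (norm_nonneg _) (norm_nonneg _)).1 ?_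
  rw [norm_sq_triple z]
  linarith [sq_nonneg ‖valL D z‖, sq_nonneg ‖gradL D z‖]

theorem norm_gradL_le (z : TripleSpace D) : ‖gradL D z‖ ≤ ‖z‖ := by
  refine (sq_le_sq₀ (norm_nonneg _) (norm_nonneg _)).1 ?_
  rw [norm_sq_triple z]
  linarith [sq_nonneg ‖valL D z‖, sq_nonneg ‖traceL D z‖]

/-- A priori bounds for the Neumann problem. -/
theorem IsLipschitzDomain.exists_apriori_bound (hd : 1 ≤ d) (hD : IsLipschitzDomain D)
    (hα : 0 < α) (hβ : 0 < β) :
    ∃ C : ℝ, 0 ≤ C ∧ ∀ (A : EuclideanSpace ℝ (Fin d) → Matrix (Fin d) (Fin d) ℝ),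
      IsCoeffField D α β A → ∀ (g : Lp ℝ 2 (surf D)) (u : H1 D), IsNeumannSolution D A g u →
        ‖u.toTriple‖ ≤ C * ‖g‖ := by
  obtain ⟨C, hC0, hC⟩ := hD.exists_norm_le_gradL hd
  refine ⟨C ^ 2 / α, by positivity, fun A hA g u hu => ?_⟩
  obtain ⟨hu0, hu⟩ := (hD.isNeumannSolution_iff hA hβ g u).1 hu
  have hmem := hD.toTriple_mem_sobolev u
  set z := u.toTriple
  have hz := hC z hmem hu0
  have htr : ‖traceL D z‖ ≤ ‖z‖ := norm_traceL_le z
  have h1 : α * ‖gradL D z‖ ^ 2 ≤ ‖g‖ * ‖z‖ := by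
    calc α * ‖gradL D z‖ ^ 2 ≤ inner ℝ g (traceL D z) := by
          rw [← hu z hmem]
          exact hA.le_form hβ _
      _ ≤ ‖g‖ * ‖traceL D z‖ := real_inner_le_norm _ _
      _ ≤ _ := by gcongr
  have h2 : α * ‖z‖ ^ 2 ≤ C ^ 2 * (‖g‖ * ‖z‖) := by
    calc α * ‖z‖ ^ 2 ≤ α * (C * ‖gradL D z‖) ^ 2 := by gcongr
      _ = C ^ 2 * (α * ‖gradL D z‖ ^ 2) := by ring
      _ ≤ _ := by gcongr
  rcases (norm_nonneg z).eq_or_lt with h0 | h0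
  · rw [← h0]
    positivity
  · rw [div_mul_eq_mul_div, le_div_iff₀ hα]
    refine le_of_mul_le_mul_right ?_ h0
    calc ‖z‖ * α * ‖z‖ = α * ‖z‖ ^ 2 := by ring
      _ ≤ C ^ 2 * (‖g‖ * ‖z‖) := h2
      _ = _ := by ring

theorem IsLipschitzDomain.exists_abs_energy_le (hd : 1 ≤ d) (hD : IsLipschitzDomain D)
    (hα : 0 < α) (hβ : 0 < β) :
    ∃ C : ℝ, ∀ (A : EuclideanSpace ℝ (Fin d) → Matrix (Fin d) (Fin d) ℝ),
      IsCoeffField D α β A → ∀ g ∈ L2m D, ‖g‖ = 1 → |energy D A g| ≤ C := by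
  obtain ⟨C, hC0, hC⟩ := hD.exists_apriori_bound hd hα hβ
  refine ⟨C, fun A hA g hg hg1 => ?_⟩
  obtain ⟨u, hu, he⟩ := hD.exists_energy_eq hd hα hβ hA hg
  have h1 := hC A hA g u hu
  have h2 : |inner ℝ g (traceL D u.toTriple)| ≤ ‖g‖ * ‖u.toTriple‖ :=
    (abs_real_inner_le_norm _ _).trans (by gcongr; exact norm_traceL_le _)
  rw [hg1, mul_one] at h1
  rw [hg1, one_mul] at h2
  rw [he, abs_mul, abs_neg, abs_of_pos (by norm_num : (0 : ℝ) < 1 / 2)]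
  linarith

theorem IsLipschitzDomain.exists_abs_energy_sub_le (hd : 1 ≤ d) (hD : IsLipschitzDomain D)
    (hα : 0 < α) (hβ : 0 < β) {g : Lp ℝ 2 (surf D)} (hg : g ∈ L2m D) :
    ∃ C : ℝ, 0 ≤ C ∧ ∀ M ∈ coeffSet d α β, ∀ N ∈ coeffSet d α β,
      |energy D (fun _ => M) g - energy D (fun _ => N) g| ≤ C * ∑ i, ∑ j, |(M - N) i j| := by
  obtain ⟨C, hC0, hC⟩ := hD.exists_apriori_bound hd hα hβ
  refine ⟨(C * ‖g‖) ^ 2, by positivity, fun M hM N hN => ?_⟩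
  have hM' : IsCoeffField D α β fun _ => M := isCoeffField_const hM
  have hN' : IsCoeffField D α β fun _ => N := isCoeffField_const hN
  obtain ⟨u, hu, hue⟩ := hD.exists_energy_eq hd hα hβ hM' hg
  obtain ⟨w, hw, hwe⟩ := hD.exists_energy_eq hd hα hβ hN' hg
  have hub := hC _ hM' g u hu
  have hwb := hC _ hN' g w hw
  -- Each equation is tested with the other solution; by symmetry both forms act on the same pair of
  -- gradients, and their difference involves only `M - N`.
  have hu' := ((hD.isNeumannSolution_iff hM' hβ g u).1 hu).2 _ (hD.toTriple_mem_sobolev w)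
  have hw' := ((hD.isNeumannSolution_iff hN' hβ g w).1 hw).2 _ (hD.toTriple_mem_sobolev u)
  rw [hM'.form_comm, hM'.form_apply] at hu'
  rw [hN'.form_apply] at hw'
  set G := gradL D u.toTriple with hG
  set H := gradL D w.toTriple with hH
  have hdiff : energy D (fun _ => M) g - energy D (fun _ => N) g =
      (1 / 2) * ∫ x in D, bilin (M - N) (G x) (H x) := by
    have : ∫ x in D, bilin (M - N) (G x) (H x) =
        (∫ x in D, bilin M (G x) (H x)) - ∫ x in D, bilin N (G x) (H x) := by
      rw [← integral_sub (integrable_bilin hM'.aemeasurable hM'.bound G H)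
        (integrable_bilin hN'.aemeasurable hN'.bound G H)]
      simp only [bilin_sub_matrix]
    rw [this, hu', hw', hue, hwe]
    ring
  have hS : 0 ≤ ∑ i, ∑ j, |(M - N) i j| :=
    Finset.sum_nonneg fun i _ => Finset.sum_nonneg fun j _ => abs_nonneg _
  have hbound := abs_integral_bilin_le (D := D) (A := fun _ => M - N)
    (fun _ _ => aemeasurable_const) hS (.of_forall fun _ => abs_bilin_le_sum (M - N)) G H
  have hGb : ‖G‖ ≤ C * ‖g‖ := (norm_gradL_le _).trans hub
  have hHb : ‖H‖ ≤ C * ‖g‖ := (norm_gradL_le _).trans hwb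
  rw [hdiff, abs_mul, abs_of_pos (by norm_num : (0 : ℝ) < 1 / 2)]
  calc 1 / 2 * |∫ x in D, bilin (M - N) (G x) (H x)|
      ≤ |∫ x in D, bilin (M - N) (G x) (H x)| := by
        linarith [abs_nonneg (∫ x in D, bilin (M - N) (G x) (H x))]
    _ ≤ (∑ i, ∑ j, |(M - N) i j|) * ‖G‖ * ‖H‖ := hbound
    _ ≤ (∑ i, ∑ j, |(M - N) i j|) * (C * ‖g‖) * (C * ‖g‖) := by gcongr
    _ = _ := by ring

theorem IsLipschitzDomain.continuousOn_energy_const (hd : 1 ≤ d) (hD : IsLipschitzDomain D)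
    (hα : 0 < α) (hβ : 0 < β) {g : Lp ℝ 2 (surf D)} (hg : g ∈ L2m D) :
    ContinuousOn (fun M : Matrix (Fin d) (Fin d) ℝ => energy D (fun _ => M) g)
      (coeffSet d α β) := by
  obtain ⟨C, -, hC⟩ := hD.exists_abs_energy_sub_le hd hα hβ hg
  intro N hN
  have hlim : Tendsto (fun M : Matrix (Fin d) (Fin d) ℝ => C * ∑ i, ∑ j, |(M - N) i j|)
      (𝓝[coeffSet d α β] N) (𝓝 0) := by
    have hc : Continuous fun M : Matrix (Fin d) (Fin d) ℝ => C * ∑ i, ∑ j, |(M - N) i j| := by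
      refine continuous_const.mul (continuous_finsetSum _ fun i _ =>
        continuous_finsetSum _ fun j _ => ?_)
      exact ((continuous_id.matrix_elem i j).sub continuous_const).abs
    simpa using (hc.tendsto N).mono_left nhdsWithin_le_nhds
  refine tendsto_iff_dist_tendsto_zero.2 (squeeze_zero' (.of_forall fun _ => dist_nonneg) ?_ hlim)
  filter_upwards [self_mem_nhdsWithin] with M hM
  exact hC M hM N hN

/-- A supremum of continuous functions is lower semicontinuous, with no uniformity in `g`. The
energy of `A` is a constant here. -/
theorem IsLipschitzDomain.lowerSemicontinuousOn_Psi (hd : 1 ≤ d) (hD : IsLipschitzDomain D)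
    (hα : 0 < α) (hβ : 0 < β)
    (A : EuclideanSpace ℝ (Fin d) → Matrix (Fin d) (Fin d) ℝ) :
    LowerSemicontinuousOn (Psi D A) (coeffSet d α β) := by
  refine lowerSemicontinuousOn_iSup fun g => lowerSemicontinuousOn_iSup fun hg => ?_
  exact (ENNReal.continuous_ofReal.comp_continuousOn
    (continuousOn_const.sub (hD.continuousOn_energy_const hd hα hβ hg.1)).abs).lowerSemicontinuousOn

theorem IsLipschitzDomain.Psi_lt_top (hd : 1 ≤ d) (hD : IsLipschitzDomain D) (hα : 0 < α)
    (hβ : 0 < β) (hA : IsCoeffField D α β A) {M : Matrix (Fin d) (Fin d) ℝ}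
    (hM : M ∈ coeffSet d α β) : Psi D A M < ⊤ := by
  obtain ⟨C, hC⟩ := hD.exists_abs_energy_le hd hα hβ
  refine lt_of_le_of_lt (iSup₂_le fun g hg => ?_) (ENNReal.ofReal_lt_top (r := C + C))
  refine ENNReal.ofReal_le_ofReal ((abs_sub _ _).trans ?_)
  exact add_le_add (hC A hA g hg.1 hg.2) (hC _ (isCoeffField_const hM) g hg.1 hg.2)

end Energy

end EffectiveCoefficient

end

/-! ### Existence of the minimizer. -/

/-- The well-posedness clause ensures that the default value `0` in `energy` is never used in the
suprema defining `Psi`. -/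
theorem proposition2 {d : ℕ} (hd : 1 ≤ d) {D : Set (EuclideanSpace ℝ (Fin d))}
    (hD : EffectiveCoefficient.IsLipschitzDomain D) {α β : ℝ} (hα : 0 < α) (hβ : 0 < β)
    {Aper : EuclideanSpace ℝ (Fin d) → Matrix (Fin d) (Fin d) ℝ}
    (hA : EffectiveCoefficient.IsPeriodicCoeff α β Aper) {ε : ℝ} (hε : 0 < ε) :
    (∀ g ∈ EffectiveCoefficient.L2m D,
      EffectiveCoefficient.WellPosed D (EffectiveCoefficient.rescale Aper ε) g ∧
      ∀ Abar ∈ EffectiveCoefficient.coeffSet d α β,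
        EffectiveCoefficient.WellPosed D (fun _ => Abar) g) ∧
    ∃ Amin ∈ EffectiveCoefficient.coeffSet d α β,
      EffectiveCoefficient.Psi D (EffectiveCoefficient.rescale Aper ε) Amin =
        (⨅ Abar ∈ EffectiveCoefficient.coeffSet d α β,
          EffectiveCoefficient.Psi D (EffectiveCoefficient.rescale Aper ε) Abar) ∧
      EffectiveCoefficient.Psi D (EffectiveCoefficient.rescale Aper ε) Amin < ⊤ := by
  have hAε : EffectiveCoefficient.IsCoeffField D α β (EffectiveCoefficient.rescale Aper ε) :=
    hA.isCoeffField_rescale hε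
  refine ⟨fun g hg => ⟨hD.wellPosed hd hα hβ hAε hg, fun M hM =>
    hD.wellPosed hd hα hβ (EffectiveCoefficient.isCoeffField_const hM) hg⟩, ?_⟩
  obtain ⟨M, hM, hmin⟩ := (hD.lowerSemicontinuousOn_Psi hd hα hβ
    (EffectiveCoefficient.rescale Aper ε)).exists_isMinOn hA.coeffSet_nonempty
    (EffectiveCoefficient.isCompact_coeffSet d α β)
  exact ⟨M, hM, le_antisymm (le_iInf₂ fun N hN => hmin hN) (iInf₂_le M hM),
    hD.Psi_lt_top hd hα hβ hAε hM⟩
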